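/- **The algorithm.** Let $\underline x\le\overline x\in\mathbb R^n$, $x_i^*=\frac12(\underline x_i+\overline x_i)$, $x_i^\Delta=\frac12(\overline x_i-\underline x_i)$, and let $\boldsymbol x_i^{1/n}=[x_i^*-\frac1n x_i^\Delta,\ x_i^*+\frac1n x_i^\Delta]$ be the narrowed intervals. The FGKLA algorithm (for maximizing $V(x)=\frac1n\sum_i(x_i-\frac1n\sum_jx_j)^2$ over $\underline x\le x\le\overline x$) works as follows. It sorts the set of all endpoints of the narrowed intervals as $a_1<\dots<a_m$ (by merge sort), and records for every $k$ the set $B_{a_k}$ of the indices whose narrowed interval begins in $a_k$ and the set $E_{a_k}$ of those whose narrowed interval ends in $a_k$. It starts with $x=\overline x$, $V_1=\frac1n\sum x_i^2$, $V_2=\frac1n\sum x_i$, $M=V_1-V_2^2$, $L=\emptyset$. For $k=1,\dots,m$ it (1) adds $B_{a_k}$ to $L$; (2) runs through all $2^{|L|}$ choices of $x_i\in\{\underline x_i,\overline x_i\}$, $i\in L$, in the cyclic order of a binary reflected Gray code kept by a binary counter, so that each of the $2^{|L|}$ steps switches one component, updates $V_1,V_2$ by $O(1)$ arithmetic operations and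 replaces $M$ by $\max(M,V_1-V_2^2)$; (3) removes the indices of $E_{a_k}$ from $L$, switches these components from $\overline x_i$ to $\underline x_i$ and updates $V_1,V_2$. It returns $M$. The running time $T(\underline x,\overline x)$ is the number of elementary steps on a unit-cost random access machine over the reals (arithmetic operations, comparisons and maxima of two numbers, array accesses, list operations and control steps cost $1$ each). Let $\omega=\omega(\underline x,\overline x)$ be the size of the largest clique of the graph on $\{1,\dots,n\}$ in which $i\ne j$ are adjacent iff $\boldsymbol x_i^{1/n}\cap\boldsymbol x_j^{1/n}\neq\emptyset$. **The probabilistic model.** Let $L>0$, $0<\varepsilon\le1$ and $\gamma$ be constants that do not depend on $n$. For every $n$ let $x_1^*,\dots,x_n^*$ be i.i.d. random variables whose distribution function $\Phi^*$ satisfies $\Phi^*(z')-\Phi^*(z)\le L(z'-z)$ for $z<z'$, and let $x_1^\Delta,\dots,x_n^\Delta$ be i.i.d. (almost surely) nonnegative random variables with $\mathsf E[(x_i^\Delta)^{1+\varepsilon}]\le\gamma$, such that the samples $(x_i^*)_i$ and $(x_i^\Delta)_i$ are independent of each other. (The distributions may depend on $n$.) The input is $\underline x_i=x_i^*-x_i^\Delta$,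 $\overline x_i=x_i^*+x_i^\Delta$; write $T_n$ and $\omega_n$ for the resulting running time and clique number. **Corollary (main result).** $T_n$ and $2^{\omega_n}$ are integrable and, as $n\to\infty$, $$\mathsf E\,T_n=O\big(n\log n+n\,\mathsf E2^{\omega_n}\big)=O\big(n\log n+n\cdot n^{1/\log\log n}\big)=O(n^{1+\eta})\quad\text{for every }\eta>0 .$$ Moreover, running time $2^{\Omega(n)}$ occurs exactly when $\omega$ is linear in $n$: (i) for every $\delta>0$ there is $c>0$ such that, for all sufficiently large $n$ and all $\underline x\le\overline x\in\mathbb R^n$, $\omega\ge\delta n$ implies $T\ge2^{cn}$; (ii) for every $c>0$ there is $\delta>0$ such that, for all sufficiently large $n$ and all $\underline x\le\overline x\in\mathbb R^n$, $T\ge2^{cn}$ implies $\omega\ge\delta n$; and these events are rare: for every $\delta>0$ and every $c>0$, $$\Pr[\omega_n\ge\delta n]=O(e^{-n\ln\ln n}),\qquad \Pr[T_n\ge2^{cn}]=O(e^{-n\ln\ln n}).$$ -/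

import Mathlib

open MeasureTheory ProbabilityTheory Filter Asymptotics

/-! ### Step counting

`Timed α` is a computation that returns a value of type `α` and the number of elementary
steps it took. The cost model is the usual unit-cost random access machine over an ordered
field: the only sources of cost are `Timed.op` and `Timed.tick`, and in the algorithm below each
`op e` performs exactly one elementary operation (one field operation, one comparison or
maximum of two numbers, one access to an input array, or the construction of one list cell or
record), while each `tick` is one control step (a loop test, a counter increment, or
the inspection of one list cell). Apart from this, only values that are already there are
passed around. -/

structure Timed (α : Type) where
  val : α
  time : ℕ

namespace Timed

instance : Monad Timed where
  pure a := ⟨a, 0⟩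
  bind m f := ⟨(f m.val).val, m.time + (f m.val).time⟩

/-- One elementary operation with result `a`. -/
def op {α : Type} (a : α) : Timed α := ⟨a, 1⟩

/-- One control step. -/
def tick : Timed Unit := ⟨(), 1⟩

@[simp] theorem val_pure {α : Type} (a : α) : (pure a : Timed α).val = a := rfl
@[simp] theorem time_pure {α : Type} (a : α) : (pure a : Timed α).time = 0 := rfl
@[simp] theorem val_bind {α β : Type} (m : Timed α) (f : α → Timed β) :
    (m >>= f).val = (f m.val).val := rfl
@[simp] theorem time_bind {α β : Type} (m : Timed α) (f : α → Timed β) :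
    (m >>= f).time = m.time + (f m.val).time := rfl
@[simp] theorem val_op {α : Type} (a : α) : (op a).val = a := rfl
@[simp] theorem time_op {α : Type} (a : α) : (op a).time = 1 := rfl
@[simp] theorem time_tick : tick.time = 1 := rfl

/-- The loop `for a in l do s := f s a`. -/
def forLoop {σ α : Type} (f : σ → α → Timed σ) : σ → List α → Timed σ
  | s, [] => do
    tick
    pure s
  | s, a :: l => do
    tick
    let s' ← f s a
    forLoop f s' l

/-- The loop `c := 0; while c < N do (s := f s; c := c + 1)`; the recursion runs over `N - c`. -/
def whileLoop {σ : Type} (f : σ → Timed σ) : ℕ → σ → Timed σ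
  | 0, s => do
    tick
    pure s
  | r + 1, s => do
    tick
    let s' ← f s
    tick
    whileLoop f r s'

end Timed

namespace FGKLA

open Timed

/-! ### Intervals, narrowed intervals and the intersection graph -/

section Graph

variable {n : ℕ}

/-- The center of the `i`th interval `[lo i, up i]`. -/
noncomputable def center (lo up : Fin n → ℝ) (i : Fin n) : ℝ := (lo i + up i) / 2

/-- The radius of the `i`th interval `[lo i, up i]`. -/
noncomputable def radius (lo up : Fin n → ℝ) (i : Fin n) : ℝ := (up i - lo i) / 2

/-- The `i`th interval, shrunk by the factor `n` around its center. -/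
def narrowed (lo up : Fin n → ℝ) (i : Fin n) : Set ℝ :=
  Set.Icc (center lo up i - 1 / (n : ℝ) * radius lo up i)
    (center lo up i + 1 / (n : ℝ) * radius lo up i)

/-- The intersection graph of the narrowed intervals. -/
def intersectionGraph (lo up : Fin n → ℝ) : SimpleGraph (Fin n) where
  Adj i j := i ≠ j ∧ (narrowed lo up i ∩ narrowed lo up j).Nonempty
  symm := ⟨fun _ _ h => ⟨h.1.symm, by rw [Set.inter_comm]; exact h.2⟩⟩
  loopless := ⟨fun _ h => h.1 rfl⟩

/-- The size of the largest clique of the intersection graph. -/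
noncomputable def omega (lo up : Fin n → ℝ) : ℕ := (intersectionGraph lo up).cliqueNum

end Graph

/-! ### The algorithm

The code is written over an arbitrary ordered field `K`; it is used with `K = ℝ`. -/

section Algorithm

variable {K : Type} [Field K] [LinearOrder K] {n : ℕ}

/-- An endpoint of the narrowed interval with number `index`. -/
structure Endpoint (K : Type) (n : ℕ) where
  value : K
  index : Fin n
  isRight : Bool

/-- A value `a = a_k` that is an endpoint of a narrowed interval, with the list `B` of the
narrowed intervals that begin in `a` and the list `E` of those that end in `a`. -/
structure Group (K : Type) (n : ℕ) where
  a : K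
  B : List (Fin n)
  E : List (Fin n)

/-- One component of the traversal: an index from `L`, with its bit `z` and its sign `s`. -/
structure Cell (K : Type) (n : ℕ) where
  index : Fin n
  z : Bool
  s : K

/-- The variables `V₁`, `V₂` (mean of squares and mean of the current vertex) and `M` (the
largest variance found so far). -/
structure Vars (K : Type) where
  V₁ : K
  V₂ : K
  M : K

def computeCenter (lo up : Fin n → K) (i : Fin n) : Timed K := do
  let a ← op (lo i)
  let b ← op (up i)
  let s ← op (a + b)
  op (s / 2)

def computeRadius (lo up : Fin n → K) (i : Fin n) : Timed K := do
  let a ← op (lo i)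
  let b ← op (up i)
  let d ← op (b - a)
  op (d / 2)

/-- Put the two endpoints of the `i`th narrowed interval in front of the list `l`. -/
def addEndpoints (lo up : Fin n → K) (l : List (Endpoint K n)) (i : Fin n) :
    Timed (List (Endpoint K n)) := do
  let c ← computeCenter lo up i
  let r ← computeRadius lo up i
  let r' ← op (r / (n : K))
  let u ← op (c - r')
  let v ← op (c + r')
  let e₁ ← op (Endpoint.mk u i false)
  let e₂ ← op (Endpoint.mk v i true)
  let l' ← op (e₂ :: l)
  op (e₁ :: l')

/-- Distribute a list into two lists of (almost) equal length. -/
def split {α : Type} : List α → Timed (List α × List α)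
  | [] => do
    tick
    pure ([], [])
  | a :: l => do
    tick
    let p ← split l
    let q ← op (a :: p.2)
    pure (q, p.1)

/-- Merge two lists of endpoints that are sorted by value. -/
def merge : List (Endpoint K n) → List (Endpoint K n) → Timed (List (Endpoint K n))
  | [], l₂ => do
    tick
    pure l₂
  | e₁ :: l₁, [] => do
    tick
    pure (e₁ :: l₁)
  | e₁ :: l₁, e₂ :: l₂ => do
    tick
    let b ← op (decide (e₁.value ≤ e₂.value))
    if b then
      let l ← merge l₁ (e₂ :: l₂)
      op (e₁ :: l)
    else
      let l ← merge (e₁ :: l₁) l₂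
      op (e₂ :: l)
termination_by l₁ l₂ => l₁.length + l₂.length

/-- Merge sort. The first argument bounds the depth of the recursion and only serves
termination: the length of the list is always enough. -/
def mergeSort : ℕ → List (Endpoint K n) → Timed (List (Endpoint K n))
  | 0, l => pure l
  | _ + 1, [] => do
    tick
    pure []
  | _ + 1, [e] => do
    tick
    pure [e]
  | d + 1, e₁ :: e₂ :: l => do
    tick
    let p ← split (e₁ :: e₂ :: l)
    let l₁ ← mergeSort d p.1
    let l₂ ← mergeSort d p.2
    merge l₁ l₂

/-- Record the endpoint `e` in a group with the same value. -/
def addToGroup (e : Endpoint K n) (g : Group K n) : Timed (Group K n) := do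
  tick
  if e.isRight then
    let E ← op (e.index :: g.E)
    op ⟨g.a, g.B, E⟩
  else
    let B ← op (e.index :: g.B)
    op ⟨g.a, B, g.E⟩

/-- Collect equal values in the sorted list of all endpoints: the result lists the
values `a_1 < ⋯ < a_m` with the sets `B_{a_k}` and `E_{a_k}`. -/
def collect : List (Endpoint K n) → Timed (List (Group K n))
  | [] => do
    tick
    pure []
  | e :: l => do
    tick
    let gs ← collect l
    tick
    match gs with
    | [] => do
      let g ← addToGroup e ⟨e.value, [], []⟩
      op [g]
    | g :: gs' => do
      let b ← op (decide (e.value = g.a))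
      if b then
        let g' ← addToGroup e g
        op (g' :: gs')
      else
        let g' ← addToGroup e ⟨e.value, [], []⟩
        op (g' :: g :: gs')

/-- Switch component `i` of the current vertex to `x_i^* + s x_i^Δ`, update `V₁` and `V₂`, and
compare the variance `V₁ - V₂ ^ 2` with `M`. -/
def switch (lo up : Fin n → K) (v : Vars K) (i : Fin n) (s : K) : Timed (Vars K) := do
  let c ← computeCenter lo up i
  let r ← computeRadius lo up i
  let t ← op (s * r)
  let p ← op (c + t)
  let q ← op (c - t)
  let p₂ ← op (p * p)
  let q₂ ← op (q * q)
  let p₃ ← op (p₂ / (n : K))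
  let q₃ ← op (q₂ / (n : K))
  let w ← op (v.V₁ + p₃)
  let V₁ ← op (w - q₃)
  let t₂ ← op (2 * t)
  let t₃ ← op (t₂ / (n : K))
  let V₂ ← op (v.V₂ + t₃)
  let V₂sq ← op (V₂ * V₂)
  let d ← op (V₁ - V₂sq)
  let M ← op (max v.M d)
  op ⟨V₁, V₂, M⟩

/-- One pass of the traversal loop: find the first component `i` with `z_i = 0`, resetting
the bits `z = 1` passed on the way (if there is none, `i` is the last component), then set
`z_i := 1`, `s_i := -s_i` and switch that component of the current vertex. -/
def advance (lo up : Fin n → K) : List (Cell K n) → Vars K → Timed (List (Cell K n) × Vars K)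
  | [], v => do
    tick
    pure ([], v)
  | [c], v => do
    tick
    let s ← op (-c.s)
    let v' ← switch lo up v c.index s
    let c' ← op (Cell.mk c.index true s)
    let l ← op [c']
    pure (l, v')
  | c :: d :: l, v => do
    tick
    if c.z then
      let c' ← op (Cell.mk c.index false c.s)
      let r ← advance lo up (d :: l) v
      let l' ← op (c' :: r.1)
      pure (l', r.2)
    else
      let s ← op (-c.s)
      let v' ← switch lo up v c.index s
      let c' ← op (Cell.mk c.index true s)
      let l' ← op (c' :: d :: l)
      pure (l', v')

/-- The components with `z = (0, …, 0)` and `s = (1, …, 1)`. -/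
def initCells : List (Fin n) → Timed (List (Cell K n))
  | [] => do
    tick
    pure []
  | i :: L => do
    tick
    let l ← initCells L
    let c ← op (Cell.mk i false 1)
    op (c :: l)

/-- The number `2 ^ |L|`. -/
def twoPow : List (Fin n) → Timed ℕ
  | [] => op 1
  | _ :: L => do
    tick
    let p ← twoPow L
    op (2 * p)

/-- Examine all `2 ^ |L|` vertices that belong to the free indices in `L`. -/
def traverse (lo up : Fin n → K) (L : List (Fin n)) (v : Vars K) : Timed (Vars K) := do
  let cells ← initCells L
  let N ← twoPow L
  let r ← whileLoop (fun p => advance lo up p.1 p.2) N (cells, v)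
  pure r.2

/-- `L ∪ {i}`, for an index that is not in `L`. -/
def insertIndex (L : List (Fin n)) (i : Fin n) : Timed (List (Fin n)) := op (i :: L)

/-- `L \ {i}`. -/
def removeIndex (i : Fin n) : List (Fin n) → Timed (List (Fin n))
  | [] => do
    tick
    pure []
  | j :: L => do
    tick
    let b ← op (decide (j = i))
    if b then
      pure L
    else
      let L' ← removeIndex i L
      op (j :: L')

/-- Remove `i` from `L` and move component `i` of the current vertex from the upper to the lower
endpoint. -/
def fixIndex (lo up : Fin n → K) (p : List (Fin n) × Vars K) (i : Fin n) :
    Timed (List (Fin n) × Vars K) := do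
  let L ← removeIndex i p.1
  let a ← op (lo i)
  let b ← op (up i)
  let a₂ ← op (a * a)
  let b₂ ← op (b * b)
  let a₃ ← op (a₂ / (n : K))
  let b₃ ← op (b₂ / (n : K))
  let w ← op (p.2.V₁ + a₃)
  let V₁ ← op (w - b₃)
  let r ← computeRadius lo up i
  let r₂ ← op (2 * r)
  let r₃ ← op (r₂ / (n : K))
  let V₂ ← op (p.2.V₂ - r₃)
  let v ← op (Vars.mk V₁ V₂ p.2.M)
  pure (L, v)

/-- The work for one value `a_k`: insert the indices of `B_{a_k}`, examine the vertices that belong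
to the free indices, remove the indices of `E_{a_k}`. -/
def visit (lo up : Fin n → K) (p : List (Fin n) × Vars K) (g : Group K n) :
    Timed (List (Fin n) × Vars K) := do
  let L ← forLoop insertIndex p.1 g.B
  let v ← traverse lo up L p.2
  forLoop (fixIndex lo up) (L, v) g.E

def addUpper (up : Fin n → K) (s : K) (i : Fin n) : Timed K := do
  let b ← op (up i)
  op (s + b)

def addUpperSq (up : Fin n → K) (s : K) (i : Fin n) : Timed K := do
  let b ← op (up i)
  let b₂ ← op (b * b)
  op (s + b₂)

/-- The algorithm: given `lo ≤ up`, it computes the largest variance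
`(1 / n) ∑ (x i - (1 / n) ∑ x j) ^ 2` over all `x` with `lo ≤ x ≤ up`. -/
def fgkla (lo up : Fin n → K) : Timed K := do
  let l ← forLoop (addEndpoints lo up) [] (List.finRange n)
  let sorted ← mergeSort l.length l
  let groups ← collect sorted
  let S₁ ← forLoop (addUpperSq up) 0 (List.finRange n)
  let V₁ ← op (S₁ / (n : K))
  let S₂ ← forLoop (addUpper up) 0 (List.finRange n)
  let V₂ ← op (S₂ / (n : K))
  let V₂sq ← op (V₂ * V₂)
  let M ← op (V₁ - V₂sq)
  let v ← op (Vars.mk V₁ V₂ M)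
  let r ← forLoop (visit lo up) ([], v) groups
  pure r.2.M

/-- The running time of the algorithm on the input `lo`, `up`. -/
def runningTime (lo up : Fin n → K) : ℕ := (fgkla lo up).time

end Algorithm

/-! ### The probabilistic model -/

/-- The centers `xc i` are i.i.d. with an `L`-Lipschitz distribution function, the radii `xr i` are
i.i.d., nonnegative and have a moment of order `1 + ε` bounded by `γ`, and the sample of
centers and the sample of radii are independent of each other. -/
structure Model {Ω : Type*} [MeasurableSpace Ω] (P : Measure Ω) {n : ℕ}
    (xc xr : Fin n → Ω → ℝ) (L γ ε : ℝ) : Prop where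
  measurable_center : ∀ i, Measurable (xc i)
  measurable_radius : ∀ i, Measurable (xr i)
  iIndep_center : iIndepFun xc P
  iIndep_radius : iIndepFun xr P
  identDistrib_center : ∀ i j, IdentDistrib (xc i) (xc j) P P
  identDistrib_radius : ∀ i j, IdentDistrib (xr i) (xr j) P P
  lipschitz_cdf : ∀ i, ∀ z z' : ℝ, z < z' →
    P.real {w | xc i w ≤ z'} - P.real {w | xc i w ≤ z} ≤ L * (z' - z)
  radius_nonneg : ∀ i, ∀ᵐ w ∂P, 0 ≤ xr i w
  integrable_moment : ∀ i, Integrable (fun w => xr i w ^ (1 + ε)) P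
  moment_le : ∀ i, ∫ w, xr i w ^ (1 + ε) ∂P ≤ γ
  indep_center_radius : IndepFun (fun w i => xc i w) (fun w i => xr i w) P

section Random

variable {Ω : Type*} {n : ℕ}

/-- The running time on the random intervals `[xc i - xr i, xc i + xr i]`. -/
noncomputable def randomTime (xc xr : Fin n → Ω → ℝ) (w : Ω) : ℕ :=
  runningTime (fun i => xc i w - xr i w) (fun i => xc i w + xr i w)

/-- The clique number for the random intervals `[xc i - xr i, xc i + xr i]`. -/
noncomputable def randomOmega (xc xr : Fin n → Ω → ℝ) (w : Ω) : ℕ :=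
  omega (fun i => xc i w - xr i w) (fun i => xc i w + xr i w)

end Random

end FGKLA

set_option linter.unusedSectionVars false

namespace FGKLA

open Timed

/-! The running time is governed by the depth of the narrowed intervals. When the main loop visits
`a`, the free list consists of the indices whose narrowed interval contains `a`, so the traversal
costs a constant times 2 to the number of these intervals. On a line, the largest number of
intervals through one point is the largest number of pairwise intersecting ones, namely ω: intervals
through a common point form a clique, and the rightmost left endpoint of a clique lies in all its
members. Amortizing the binary counter and charging insertions and removals to the 2n endpoints
gives 2^ω ≤ T = O(n log n + n 2^ω) for every input (`two_pow_omega_le_runningTime`,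
`runningTime_le_omega`). The equivalence of exponential running time and linear clique number
follows from these two inequalities alone.

The probabilistic core is the bound E Q^ω ≤ n Q exp(4L(1+γ)Q) for every natural number Q ≥ 1
(`lintegral_pow_omega_le`). In a largest clique take the member i of least radius; every other
member j then satisfies |x_i - x_j| ≤ 2r_j/n, a condition that does not involve r_i. Given x_i,
these conditions are independent over j, and each holds with probability O(1/n) by the Lipschitz
bound and the bounded mean radius. Summing over the possible i gives the claim.

Two choices of Q finish the proof. With Q = 2^p and p about (6/5) log log n, the moment of order p
of 2^ω bounds its mean by 4 n^(1/log log n) (`eventually_integral_two_pow_omega_le`). With Q about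
√n, Markov's inequality makes ω ≥ δn as unlikely as exp(-n log log n) (`isBigO_measureReal_omega`);
the tail of T follows because a large T forces a large ω.

Measurability comes from the order pattern of the endpoints: T and ω depend on nothing else, and
there are only finitely many patterns. -/

theorem time_forLoop_le {σ α : Type} (f : σ → α → Timed σ) (c : ℕ) (l : List α)
    (h : ∀ s, ∀ a ∈ l, (f s a).time ≤ c) (s : σ) :
    (forLoop f s l).time ≤ l.length * (c + 1) + 1 := by
  induction l generalizing s with
  | nil => simp [forLoop]
  | cons a l ih =>
    have h1 := h s a (by simp)
    have h2 := ih (fun s b hb => h s b (by simp [hb])) (f s a).val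
    simp only [forLoop, time_bind, time_tick, List.length_cons]
    linarith

/-! ### Cost and correctness of the sorting phase -/

section Cost

variable {K : Type} [Field K] [LinearOrder K] {n : ℕ}

theorem time_addEndpoints (lo up : Fin n → K) (l : List (Endpoint K n)) (i : Fin n) :
    (addEndpoints lo up l i).time = 15 := rfl

theorem time_switch (lo up : Fin n → K) (v : Vars K) (i : Fin n) (s : K) :
    (switch lo up v i s).time = 24 := by
  simp only [switch, computeCenter, computeRadius, time_bind, time_op]

theorem time_split_le {α : Type} (l : List α) : (split l).time = 2 * l.length + 1 := by
  induction l with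
  | nil => rfl
  | cons a l ih =>
    simp only [split, time_bind, time_tick, ih, time_op, time_pure, List.length_cons]
    ring

theorem length_split {α : Type} (l : List α) :
    (split l).val.1.length = (l.length + 1) / 2 ∧ (split l).val.2.length = l.length / 2 := by
  induction l with
  | nil => simp [split]
  | cons a l ih =>
    refine ⟨?_, ?_⟩
    · simp [split, ih.2]
      omega
    · simp [split, ih.1]

theorem perm_split {α : Type} (l : List α) :
    ((split l).val.1 ++ (split l).val.2).Perm l := by
  induction l with
  | nil => exact List.Perm.refl _
  | cons a l ih =>
    simp only [split, val_bind, val_op, val_pure, List.cons_append]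
    exact (List.perm_append_comm.trans ih).cons a

theorem time_merge_le (l₁ l₂ : List (Endpoint K n)) :
    (merge l₁ l₂).time ≤ 3 * (l₁.length + l₂.length) + 1 := by
  fun_induction merge l₁ l₂ with
  | case1 => simp
  | case2 => simp
  | case3 e₁ l₁ e₂ l₂ ih₁ ih₂ =>
    simp only [time_bind, time_tick, val_op, time_op]
    by_cases h : e₁.value ≤ e₂.value
    · simp only [h, decide_true, if_true, time_bind, time_op, List.length_cons] at *
      omega
    · simp only [h, decide_false, Bool.false_eq_true, if_false, time_bind, time_op,
        List.length_cons] at *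
      omega

theorem perm_merge (l₁ l₂ : List (Endpoint K n)) : (merge l₁ l₂).val.Perm (l₁ ++ l₂) := by
  fun_induction merge l₁ l₂ with
  | case1 => simp
  | case2 => simp
  | case3 e₁ l₁ e₂ l₂ ih₁ ih₂ =>
    simp only [val_bind, val_op]
    by_cases h : e₁.value ≤ e₂.value
    · simpa [h] using ih₁
    · simp only [h, decide_false, Bool.false_eq_true, if_false, val_bind, val_op]
      exact (ih₂.cons e₂).trans List.perm_middle.symm

theorem pairwise_merge (l₁ l₂ : List (Endpoint K n))
    (h₁ : l₁.Pairwise (fun e e' => e.value ≤ e'.value))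
    (h₂ : l₂.Pairwise (fun e e' => e.value ≤ e'.value)) :
    (merge l₁ l₂).val.Pairwise (fun e e' => e.value ≤ e'.value) := by
  fun_induction merge l₁ l₂ with
  | case1 => simpa
  | case2 => exact h₁
  | case3 e₁ l₁ e₂ l₂ ih₁ ih₂ =>
    simp only [val_bind, val_op]
    have h₁' := List.pairwise_cons.1 h₁
    have h₂' := List.pairwise_cons.1 h₂
    by_cases h : e₁.value ≤ e₂.value
    · simp only [h, decide_true, if_true, val_bind, val_op]
      refine List.pairwise_cons.2 ⟨fun e he => ?_, ih₁ h₁'.2 h₂⟩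
      rcases List.mem_append.1 ((perm_merge _ _).subset he) with he | he
      · exact h₁'.1 e he
      · rcases List.mem_cons.1 he with rfl | he
        · exact h
        · exact h.trans (h₂'.1 e he)
    · simp only [h, decide_false, Bool.false_eq_true, if_false, val_bind, val_op]
      refine List.pairwise_cons.2 ⟨fun e he => ?_, ih₂ h₁ h₂'.2⟩
      rcases List.mem_append.1 ((perm_merge _ _).subset he) with he | he
      · rcases List.mem_cons.1 he with rfl | he
        · exact (not_le.1 h).le
        · exact (not_le.1 h).le.trans (h₁'.1 e he)
      · exact h₂'.1 e he

theorem perm_mergeSort (d : ℕ) (l : List (Endpoint K n)) : (mergeSort d l).val.Perm l := by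
  fun_induction mergeSort d l with
  | case1 => simp
  | case2 => simp
  | case3 => simp
  | case4 d e₁ e₂ l ih₁ ih₂ =>
    simp only [val_bind]
    exact (perm_merge _ _).trans (((ih₁ _).append (ih₂ _)).trans (perm_split _))

theorem pairwise_mergeSort (d : ℕ) (l : List (Endpoint K n)) (h : l.length ≤ d) :
    (mergeSort d l).val.Pairwise (fun e e' => e.value ≤ e'.value) := by
  fun_induction mergeSort d l with
  | case1 l => simp [List.length_eq_zero_iff.1 (Nat.le_zero.1 h)]
  | case2 => simp
  | case3 => simp
  | case4 d e₁ e₂ l ih₁ ih₂ =>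
    simp only [val_bind]
    have hs := length_split (e₁ :: e₂ :: l)
    simp only [List.length_cons] at hs h
    exact pairwise_merge _ _ (ih₁ _ (by omega)) (ih₂ _ (by omega))

/-- Splitting and merging a list of length N, with the control step, cost at most 5N + 3 in total.
Adding 3 to the time therefore turns the recursion into S(N) ≤ S(⌈N/2⌉) + S(⌊N/2⌋) + 5N without
additive constant, and S(1) = 4 explains the term 4N. -/
theorem time_mergeSort_add_le (d : ℕ) (l : List (Endpoint K n)) (h : 1 ≤ l.length) :
    (mergeSort d l).time + 3 ≤ 5 * l.length * Nat.clog 2 l.length + 4 * l.length := by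
  fun_induction mergeSort d l with
  | case1 l => simp only [time_pure]; nlinarith [Nat.zero_le (5 * l.length * Nat.clog 2 l.length)]
  | case2 => simp at h
  | case3 => simp
  | case4 d e₁ e₂ l ih₁ ih₂ =>
    have hs := length_split (e₁ :: e₂ :: l)
    have ht := time_split_le (e₁ :: e₂ :: l)
    obtain ⟨N, hN⟩ : ∃ N, N = (e₁ :: e₂ :: l).length := ⟨_, rfl⟩
    have hN2 : 2 ≤ N := by simp [hN]
    rw [← hN] at hs ht ⊢
    have i₁ := ih₁ (split (e₁ :: e₂ :: l)).val (by omega)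
    have i₂ := ih₂ (split (e₁ :: e₂ :: l)).val (by omega)
    simp only [time_bind, time_tick]
    have hm := time_merge_le (mergeSort d (split (e₁ :: e₂ :: l)).val.1).val
      (mergeSort d (split (e₁ :: e₂ :: l)).val.2).val
    rw [(perm_mergeSort _ _).length_eq, (perm_mergeSort _ _).length_eq] at hm
    rw [hs.1] at i₁ hm
    rw [hs.2] at i₂ hm
    -- The larger half has exactly one level of recursion less, and the smaller half no more than
    -- that.
    have c0 : Nat.clog 2 N = Nat.clog 2 ((N + 1) / 2) + 1 := by
      rw [Nat.clog_of_two_le (by norm_num) hN2, show N + 2 - 1 = N + 1 by omega]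
    have c1 : Nat.clog 2 (N / 2) ≤ Nat.clog 2 ((N + 1) / 2) :=
      Nat.clog_mono_right 2 (by omega)
    obtain ⟨x, hx⟩ : ∃ x, x = (N + 1) / 2 := ⟨_, rfl⟩
    obtain ⟨y, hy⟩ : ∃ y, y = N / 2 := ⟨_, rfl⟩
    have hxy : N = x + y := by omega
    rw [← hx] at i₁ hm c0 c1
    rw [← hy] at i₂ hm c1
    have c2 : 5 * y * Nat.clog 2 y ≤ 5 * y * Nat.clog 2 x := Nat.mul_le_mul_left _ c1
    rw [c0, ht]
    have : 5 * N * (Nat.clog 2 x + 1) = 5 * x * Nat.clog 2 x + 5 * y * Nat.clog 2 x + 5 * N := by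
      rw [hxy]; ring
    rw [this]
    omega

theorem time_mergeSort_le (d : ℕ) (l : List (Endpoint K n)) :
    (mergeSort d l).time ≤ 5 * l.length * Nat.clog 2 l.length + 4 * l.length + 1 := by
  rcases Nat.eq_zero_or_pos l.length with h | h
  · rw [List.length_eq_zero_iff] at h
    subst h
    cases d <;> simp [mergeSort]
  · have := time_mergeSort_add_le d l h
    omega

/-! ### The traversal -/

/-- The number of components with bit `1`. -/
def ones (l : List (Cell K n)) : ℕ := l.countP (fun c => c.z)

/-- Amortized analysis with potential 3 per bit 1. Resetting a bit takes 3 steps and releases 3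
units; the one switch that ends the pass takes 28 steps and raises the potential by at most 3,
whence 31. -/
theorem time_advance_add_le (lo up : Fin n → K) (l : List (Cell K n)) (v : Vars K) :
    (advance lo up l v).time + 3 * ones (advance lo up l v).val.1 ≤ 31 + 3 * ones l := by
  fun_induction advance lo up l v with
  | case1 => simp [ones]
  | case2 v c =>
    simp only [time_bind, val_bind, time_tick, time_op, val_op, time_switch, time_pure, val_pure,
      ones, List.countP_cons, List.countP_nil]
    simp
  | case3 v c d l ih =>
    simp only [time_bind, val_bind, time_tick]
    split_ifs with h
    · simp only [time_bind, val_bind, time_op, val_op, time_pure, val_pure, ones,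
        List.countP_cons] at *
      simp [h] at *
      omega
    · simp only [time_bind, val_bind, time_op, val_op, time_pure, val_pure, time_switch, ones,
        List.countP_cons] at *
      simp [h] at *
      omega

/-- The potential telescopes over the passes; 33 is the amortized 31 plus two control steps of the
loop. -/
theorem time_whileLoop_advance_le (lo up : Fin n → K) (N : ℕ) (p : List (Cell K n) × Vars K) :
    (whileLoop (fun p => advance lo up p.1 p.2) N p).time ≤ 33 * N + 1 + 3 * ones p.1 := by
  induction N generalizing p with
  | zero => simp [whileLoop]
  | succ N ih =>
    have h1 := time_advance_add_le lo up p.1 p.2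
    have h2 := ih (advance lo up p.1 p.2).val
    simp only [whileLoop, time_bind, time_tick]
    omega

theorem le_time_whileLoop {σ : Type} (f : σ → Timed σ) (N : ℕ) (s : σ) :
    N ≤ (whileLoop f N s).time := by
  induction N generalizing s with
  | zero => simp
  | succ N ih =>
    have := ih (f s).val
    simp only [whileLoop, time_bind, time_tick]
    omega

theorem time_initCells (L : List (Fin n)) :
    (initCells L : Timed (List (Cell K n))).time = 3 * L.length + 1 := by
  induction L with
  | nil => rfl
  | cons i L ih =>
    simp only [initCells, time_bind, time_tick, time_op, ih, List.length_cons]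
    ring

theorem ones_initCells (L : List (Fin n)) :
    ones (initCells L : Timed (List (Cell K n))).val = 0 := by
  induction L with
  | nil => rfl
  | cons i L ih =>
    simp only [initCells, val_bind, val_op, ones, List.countP_cons] at *
    simp [ih]

theorem time_twoPow (L : List (Fin n)) : (twoPow L).time = 2 * L.length + 1 := by
  induction L with
  | nil => rfl
  | cons i L ih =>
    simp only [twoPow, time_bind, time_tick, time_op, ih, List.length_cons]
    ring

theorem val_twoPow (L : List (Fin n)) : (twoPow L).val = 2 ^ L.length := by
  induction L with
  | nil => rfl
  | cons i L ih => simp only [twoPow, val_bind, val_op, ih, List.length_cons, pow_succ']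

/-- All bits start at 0, so there is no initial potential, and the linear cost of the preparation is
absorbed by 2^|L|. -/
theorem time_traverse_le (lo up : Fin n → K) (L : List (Fin n)) (v : Vars K) :
    (traverse lo up L v).time ≤ 41 * 2 ^ L.length := by
  have h1 := time_whileLoop_advance_le lo up (2 ^ L.length)
    ((initCells L : Timed (List (Cell K n))).val, v)
  have h2 : L.length < 2 ^ L.length := Nat.lt_two_pow_self
  simp only [traverse, time_bind, time_initCells, time_twoPow, val_twoPow, time_pure]
  rw [ones_initCells] at h1
  omega

theorem le_time_traverse (lo up : Fin n → K) (L : List (Fin n)) (v : Vars K) :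
    2 ^ L.length ≤ (traverse lo up L v).time := by
  have h1 := le_time_whileLoop (fun p => advance lo up p.1 p.2) (2 ^ L.length)
    ((initCells L : Timed (List (Cell K n))).val, v)
  simp only [traverse, time_bind, val_twoPow, time_pure]
  omega

theorem val_insertLoop (L B : List (Fin n)) :
    (forLoop insertIndex L B).val = B.reverse ++ L := by
  induction B generalizing L with
  | nil => rfl
  | cons i B ih => simp [forLoop, insertIndex, ih]

theorem val_removeIndex (i : Fin n) (L : List (Fin n)) : (removeIndex i L).val = L.erase i := by
  induction L with
  | nil => rfl
  | cons j L ih =>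
    simp only [removeIndex, val_bind, val_op]
    by_cases h : j = i
    · simp [h]
    · simp [h, ih]

theorem time_removeIndex_le (i : Fin n) (L : List (Fin n)) :
    (removeIndex i L).time ≤ 3 * L.length + 1 := by
  induction L with
  | nil => simp [removeIndex]
  | cons j L ih =>
    simp only [removeIndex, time_bind, time_tick, time_op, val_op, List.length_cons]
    by_cases h : j = i
    · simp [h]
      omega
    · simp [h]
      omega

theorem time_fixIndex_le (lo up : Fin n → K) (p : List (Fin n) × Vars K) (i : Fin n) :
    (fixIndex lo up p i).time ≤ 3 * p.1.length + 17 := by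
  have h := time_removeIndex_le i p.1
  have : (fixIndex lo up p i).time = (removeIndex i p.1).time + 16 := rfl
  omega

theorem val_fixIndex_fst (lo up : Fin n → K) (p : List (Fin n) × Vars K) (i : Fin n) :
    (fixIndex lo up p i).val.1 = p.1.erase i :=
  val_removeIndex i p.1

theorem val_fixLoop_fst (lo up : Fin n → K) (p : List (Fin n) × Vars K) (E : List (Fin n)) :
    (forLoop (fixIndex lo up) p E).val.1 = p.1.diff E := by
  induction E generalizing p with
  | nil => rfl
  | cons i E ih =>
    simp only [forLoop, val_bind, List.diff_cons]
    rw [ih, val_fixIndex_fst]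

theorem time_fixLoop_le (lo up : Fin n → K) (p : List (Fin n) × Vars K) (E : List (Fin n)) :
    (forLoop (fixIndex lo up) p E).time ≤ (3 * p.1.length + 18) * E.length + 1 := by
  induction E generalizing p with
  | nil => simp [forLoop]
  | cons i E ih =>
    have h1 := ih (fixIndex lo up p i).val
    have h2 := time_fixIndex_le lo up p i
    have h3 : (fixIndex lo up p i).val.1.length ≤ p.1.length := by
      rw [val_fixIndex_fst]; exact List.length_erase_le
    have h4 : (3 * (fixIndex lo up p i).val.1.length + 18) * E.length ≤
        (3 * p.1.length + 18) * E.length := Nat.mul_le_mul_right _ (by omega)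
    simp only [forLoop, time_bind, time_tick, List.length_cons, Nat.mul_succ]
    omega

/-- Each removal scans a list of at most `w` indices; since w + 1 ≤ 2^w, this scan is also paid by
the factor 2^w. -/
theorem time_visit_le (lo up : Fin n → K) (p : List (Fin n) × Vars K) (g : Group K n) (w : ℕ)
    (h : g.B.length + p.1.length ≤ w) :
    (visit lo up p g).time ≤ 2 ^ w * (43 + 21 * (g.B.length + g.E.length)) := by
  have h1 : (forLoop insertIndex p.1 g.B).time ≤ g.B.length * 2 + 1 :=
    time_forLoop_le _ 1 _ (fun _ _ _ => le_rfl) _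
  have hl : (forLoop insertIndex p.1 g.B).val.length ≤ w := by
    simpa [val_insertLoop] using h
  have h2 := time_traverse_le lo up (forLoop insertIndex p.1 g.B).val p.2
  have h3 := time_fixLoop_le lo up ((forLoop insertIndex p.1 g.B).val,
    (traverse lo up (forLoop insertIndex p.1 g.B).val p.2).val) g.E
  have h4 : 2 ^ (forLoop insertIndex p.1 g.B).val.length ≤ 2 ^ w :=
    Nat.pow_le_pow_right (by norm_num) hl
  have h5 : w + 1 ≤ 2 ^ w := Nat.lt_two_pow_self
  have h6 : (3 * (forLoop insertIndex p.1 g.B).val.length + 18) * g.E.length ≤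
      (21 * 2 ^ w) * g.E.length := Nat.mul_le_mul_right _ (by omega)
  have h7 : 1 * g.B.length ≤ 2 ^ w * g.B.length := Nat.mul_le_mul_right _ (by omega)
  simp only [visit, time_bind]
  have : 2 ^ w * (43 + 21 * (g.B.length + g.E.length)) =
    43 * 2 ^ w + 21 * (2 ^ w * g.B.length) + 21 * 2 ^ w * g.E.length := by ring
  rw [this]
  dsimp only at h3
  omega

theorem le_time_visit (lo up : Fin n → K) (p : List (Fin n) × Vars K) (g : Group K n) :
    2 ^ (g.B.length + p.1.length) ≤ (visit lo up p g).time := by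
  have h := le_time_traverse lo up (forLoop insertIndex p.1 g.B).val p.2
  have hl : (forLoop insertIndex p.1 g.B).val.length = g.B.length + p.1.length := by
    simp [val_insertLoop]
  rw [hl] at h
  simp only [visit, time_bind]
  omega

theorem val_visit_fst (lo up : Fin n → K) (p : List (Fin n) × Vars K) (g : Group K n) :
    (visit lo up p g).val.1 = (g.B.reverse ++ p.1).diff g.E := by
  simp only [visit, val_bind]
  rw [val_fixLoop_fst, val_insertLoop]

end Cost

/-! ### Grouping of equal endpoints, and the free list as a loop invariant -/

section Groups

variable {K : Type} [Field K] [LinearOrder K] {n : ℕ}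

/-- The list of right (`b = true`) or left (`b = false`) endpoints recorded in a group. -/
def Group.side (g : Group K n) (b : Bool) : List (Fin n) := if b then g.E else g.B

theorem mem_side_addToGroup (e : Endpoint K n) (g : Group K n) (i : Fin n) (b : Bool) :
    i ∈ (addToGroup e g).val.side b ↔ i ∈ g.side b ∨ (e.isRight = b ∧ e.index = i) := by
  rcases e with ⟨a, j, r⟩
  cases r <;> cases b <;> simp [addToGroup, Group.side, or_comm, eq_comm]

theorem a_addToGroup (e : Endpoint K n) (g : Group K n) : (addToGroup e g).val.a = g.a := by
  rcases e with ⟨a, j, r⟩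
  cases r <;> simp [addToGroup]

theorem nodup_addToGroup (e : Endpoint K n) (g : Group K n) (hg : g.B.Nodup)
    (h : e.isRight = false → e.index ∉ g.B) : (addToGroup e g).val.B.Nodup := by
  rcases e with ⟨a, j, r⟩
  cases r
  · simpa [addToGroup, hg] using h
  · simpa [addToGroup] using hg

theorem length_addToGroup (e : Endpoint K n) (g : Group K n) :
    (addToGroup e g).val.B.length + (addToGroup e g).val.E.length =
      g.B.length + g.E.length + 1 := by
  rcases e with ⟨a, j, r⟩
  cases r <;> simp [addToGroup] <;> omega

theorem time_addToGroup (e : Endpoint K n) (g : Group K n) : (addToGroup e g).time = 3 := by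
  rcases e with ⟨a, j, r⟩
  cases r <;> simp [addToGroup]

/-- Separates the two outcomes of adding an endpoint, a new group or an extension of the head group.
Stating the first with `head?` lets it cover an empty remainder as well. -/
theorem val_collect_cons (e : Endpoint K n) (l : List (Endpoint K n)) :
    (collect (e :: l)).val =
        (addToGroup e ⟨e.value, [], []⟩).val :: (collect l).val ∧
      (∀ g ∈ (collect l).val.head?, e.value ≠ g.a) ∨
    ∃ g gs, (collect l).val = g :: gs ∧ e.value = g.a ∧
      (collect (e :: l)).val = (addToGroup e g).val :: gs := by
  simp only [collect, val_bind]
  rcases (collect l).val with _ | ⟨g, gs⟩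
  · simp
  · by_cases h : e.value = g.a
    · exact Or.inr ⟨g, gs, rfl, h, by simp [h]⟩
    · exact Or.inl ⟨by simp [h], by simpa using h⟩

theorem time_collect_le (l : List (Endpoint K n)) : (collect l).time ≤ 7 * l.length + 1 := by
  induction l with
  | nil => simp [collect]
  | cons e l ih =>
    simp only [collect, time_bind, time_tick]
    rcases (collect l).val with _ | ⟨g, gs⟩
    · simp [time_addToGroup]
      omega
    · by_cases h : e.value = g.a
      · simp [h, time_addToGroup]
        omega
      · simp [h, time_addToGroup]
        omega

theorem length_collect_le (l : List (Endpoint K n)) : (collect l).val.length ≤ l.length := by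
  induction l with
  | nil => simp [collect]
  | cons e l ih =>
    rcases val_collect_cons e l with ⟨h, -⟩ | ⟨g, gs, h₁, -, h⟩
    · simp [h, ih]
    · rw [h₁] at ih
      rw [h]
      simp only [List.length_cons] at *
      omega

theorem sum_collect (l : List (Endpoint K n)) :
    ((collect l).val.map (fun g => g.B.length + g.E.length)).sum = l.length := by
  induction l with
  | nil => simp [collect]
  | cons e l ih =>
    rcases val_collect_cons e l with ⟨h, -⟩ | ⟨g, gs, h₁, -, h⟩
    · rw [h]
      simp [ih, length_addToGroup]
      omega
    · rw [h₁] at ih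
      rw [h]
      simp only [List.map_cons, List.sum_cons, length_addToGroup, List.length_cons] at *
      omega

/-- The groups collected from a sorted list: their values are strictly increasing, they are the
values that occur in the list, and every group records the endpoints with its value. -/
theorem collect_spec (s : List (Endpoint K n))
    (hs : s.Pairwise (fun e e' => e.value ≤ e'.value)) :
    (collect s).val.Pairwise (fun g g' => g.a < g'.a) ∧
    (∀ g ∈ (collect s).val, ∀ i b, i ∈ g.side b ↔ ⟨g.a, i, b⟩ ∈ s) ∧
    (∀ e ∈ s, ∃ g ∈ (collect s).val, g.a = e.value) ∧
    (∀ g ∈ (collect s).val, ∃ e ∈ s, g.a = e.value) := by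
  induction s with
  | nil => simp [collect]
  | cons e l ih =>
    obtain ⟨he, hl⟩ := List.pairwise_cons.1 hs
    obtain ⟨i₁, i₂, i₃, i₄⟩ := ih hl
    rcases val_collect_cons e l with ⟨h, h₀⟩ | ⟨g, gs, h₁, hg, h⟩
    · have hlt : ∀ g ∈ (collect l).val, e.value < g.a := by
        intro g hg
        rcases hc : (collect l).val with _ | ⟨g₀, gs⟩
        · simp [hc] at hg
        · rw [hc] at hg h₀ i₁ i₄
          have hlt₀ : e.value < g₀.a := by
            obtain ⟨e', he', hv⟩ := i₄ g₀ (by simp)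
            exact lt_of_le_of_ne (hv ▸ he e' he') (h₀ g₀ (by simp))
          rcases List.mem_cons.1 hg with rfl | hg
          · exact hlt₀
          · exact hlt₀.trans ((List.pairwise_cons.1 i₁).1 g hg)
      rw [h]
      refine ⟨List.pairwise_cons.2 ⟨fun g hg => ?_, i₁⟩, ?_, ?_, ?_⟩
      · rw [a_addToGroup]; exact hlt g hg
      · intro g hg i b
        rcases List.mem_cons.1 hg with rfl | hg
        · rw [mem_side_addToGroup, a_addToGroup]
          -- An endpoint of this value further down the list would already have produced a group of
          -- the same value, but all those groups lie strictly to the right.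
          have hn : (⟨e.value, i, b⟩ : Endpoint K n) ∉ l := fun hm => by
            obtain ⟨g, hg, hv⟩ := i₃ _ hm
            exact absurd (hlt g hg) (by simp [hv])
          rcases e with ⟨a, j, r⟩
          simp only [List.mem_cons, hn, or_false, Endpoint.mk.injEq, true_and]
          cases b <;> simp [Group.side, eq_comm, and_comm]
        · rw [i₂ g hg]
          have : (⟨g.a, i, b⟩ : Endpoint K n) ≠ e := fun h' => by
            have := hlt g hg
            rw [← h'] at this
            exact lt_irrefl _ this
          simp [this]
      · intro e' he'
        rcases List.mem_cons.1 he' with rfl | he'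
        · exact ⟨_, List.mem_cons_self, a_addToGroup _ _⟩
        · obtain ⟨g, hg, hv⟩ := i₃ e' he'
          exact ⟨g, List.mem_cons_of_mem _ hg, hv⟩
      · intro g hg
        rcases List.mem_cons.1 hg with rfl | hg
        · exact ⟨e, List.mem_cons_self, a_addToGroup _ _⟩
        · obtain ⟨e', he', hv⟩ := i₄ g hg
          exact ⟨e', List.mem_cons_of_mem _ he', hv⟩
    · rw [h₁] at i₁ i₂ i₃ i₄
      rw [h]
      obtain ⟨hlt, i₁'⟩ := List.pairwise_cons.1 i₁
      refine ⟨List.pairwise_cons.2 ⟨fun g' hg' => ?_, i₁'⟩, ?_, ?_, ?_⟩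
      · rw [a_addToGroup]; exact hlt g' hg'
      · intro g' hg' i b
        rcases List.mem_cons.1 hg' with rfl | hg'
        · rw [mem_side_addToGroup, a_addToGroup, i₂ g List.mem_cons_self, List.mem_cons, ← hg,
            or_comm]
          rcases e with ⟨a, j, r⟩
          simp [eq_comm, and_comm]
        · rw [i₂ g' (List.mem_cons_of_mem _ hg')]
          have : (⟨g'.a, i, b⟩ : Endpoint K n) ≠ e := fun h' => by
            have := hlt g' hg'
            rw [← hg, ← h'] at this
            exact lt_irrefl _ this
          simp [this]
      · intro e' he'
        rcases List.mem_cons.1 he' with rfl | he'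
        · exact ⟨_, List.mem_cons_self, by rw [a_addToGroup, hg]⟩
        · obtain ⟨g', hg', hv⟩ := i₃ e' he'
          rcases List.mem_cons.1 hg' with rfl | hg'
          · exact ⟨_, List.mem_cons_self, by rw [a_addToGroup, hv]⟩
          · exact ⟨g', List.mem_cons_of_mem _ hg', hv⟩
      · intro g' hg'
        rcases List.mem_cons.1 hg' with rfl | hg'
        · exact ⟨e, List.mem_cons_self, by rw [a_addToGroup, hg]⟩
        · obtain ⟨e', he', hv⟩ := i₄ g' (List.mem_cons_of_mem _ hg')
          exact ⟨e', List.mem_cons_of_mem _ he', hv⟩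

/-- `insertIndex` does not test membership, so a repetition in `B` would make the traversal longer
than the number of active intervals accounts for. -/
theorem nodup_collect (s : List (Endpoint K n))
    (hs : s.Pairwise (fun e e' => e.value ≤ e'.value)) (hn : s.Nodup) :
    ∀ g ∈ (collect s).val, g.B.Nodup := by
  induction s with
  | nil => simp [collect]
  | cons e l ih =>
    obtain ⟨he, hl⟩ := List.pairwise_cons.1 hs
    obtain ⟨hne, hnl⟩ := List.nodup_cons.1 hn
    have ih' := ih hl hnl
    rcases val_collect_cons e l with ⟨h, h₀⟩ | ⟨g, gs, h₁, hg, h⟩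
    · rw [h]
      intro g hg
      rcases List.mem_cons.1 hg with rfl | hg
      · exact nodup_addToGroup _ _ (by simp) (by simp)
      · exact ih' g hg
    · rw [h]
      rw [h₁] at ih'
      intro g' hg'
      rcases List.mem_cons.1 hg' with rfl | hg'
      · refine nodup_addToGroup _ _ (ih' g List.mem_cons_self) fun hr hm => hne ?_
        have := ((collect_spec l hl).2.1 g (h₁ ▸ List.mem_cons_self) e.index false).1 hm
        rw [← hg, ← hr] at this
        exact this
      · exact ih' g' (List.mem_cons_of_mem _ hg')

/-- The indices whose interval `[u i, v i]` contains `a`. -/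
def active (u v : Fin n → K) (a : K) : Finset (Fin n) := {i | u i ≤ a ∧ a ≤ v i}

/-- The state of the main loop after the groups in `pre`, when the groups in `gs` remain. -/
structure LoopInvariant (u v : Fin n → K) (pre gs : List (Group K n)) (L : List (Fin n)) :
    Prop where
  pairwise : (pre ++ gs).Pairwise (fun g g' => g.a < g'.a)
  mem_B : ∀ g ∈ gs, ∀ i, i ∈ g.B ↔ u i = g.a
  mem_E : ∀ g ∈ gs, ∀ i, i ∈ g.E ↔ v i = g.a
  nodup_B : ∀ g ∈ gs, g.B.Nodup
  left_mem : ∀ i, ∃ g ∈ pre ++ gs, g.a = u i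
  right_mem : ∀ i, ∃ g ∈ pre ++ gs, g.a = v i
  le : ∀ i, u i ≤ v i
  nodup : L.Nodup
  mem : ∀ i, i ∈ L ↔ (∃ g ∈ pre, g.a = u i) ∧ ∀ g ∈ pre, g.a ≠ v i

namespace LoopInvariant

variable {u v : Fin n → K} {pre gs : List (Group K n)} {g : Group K n} {L : List (Fin n)}

theorem lt_of_mem (h : LoopInvariant u v pre (g :: gs) L) {g' : Group K n} (hg' : g' ∈ pre) :
    g'.a < g.a :=
  (List.pairwise_append.1 h.pairwise).2.2 g' hg' g List.mem_cons_self

/-- All endpoints are group values and these increase strictly, so "already visited" means "smaller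
than `g.a`". An interval that has begun and was not yet removed is therefore one that contains
`g.a`. -/
theorem mem_insert (h : LoopInvariant u v pre (g :: gs) L) (i : Fin n) :
    i ∈ g.B.reverse ++ L ↔ u i ≤ g.a ∧ g.a ≤ v i := by
  have hgt : ∀ g' ∈ gs, g.a < g'.a := fun g' hg' =>
    (List.pairwise_cons.1 (List.pairwise_append.1 h.pairwise).2.1).1 g' hg'
  rw [List.mem_append, List.mem_reverse, h.mem_B g List.mem_cons_self, h.mem]
  constructor
  · rintro (hi | ⟨⟨g', hg', hu⟩, hv⟩)
    · exact ⟨hi.le, hi ▸ h.le i⟩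
    · refine ⟨hu ▸ (h.lt_of_mem hg').le, ?_⟩
      obtain ⟨g'', hg'', hv'⟩ := h.right_mem i
      rcases List.mem_append.1 hg'' with hm | hm
      · exact absurd hv' (hv _ hm)
      · rcases List.mem_cons.1 hm with rfl | hm
        · exact hv'.le
        · exact hv' ▸ (hgt _ hm).le
  · rintro ⟨h₁, h₂⟩
    obtain ⟨g', hg', hu⟩ := h.left_mem i
    rcases List.mem_append.1 hg' with hm | hm
    · exact Or.inr ⟨⟨g', hm, hu⟩, fun g'' hg'' hv =>
        absurd (h.lt_of_mem hg'') (by rw [hv]; exact not_lt.2 h₂)⟩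
    · rcases List.mem_cons.1 hm with rfl | hm
      · exact Or.inl hu.symm
      · exact absurd (hgt _ hm) (by rw [hu]; exact not_lt.2 h₁)

theorem nodup_insert (h : LoopInvariant u v pre (g :: gs) L) : (g.B.reverse ++ L).Nodup := by
  refine List.nodup_append.2 ⟨List.nodup_reverse.2 (h.nodup_B g List.mem_cons_self), h.nodup, ?_⟩
  rintro i hi j hj rfl
  rw [List.mem_reverse, h.mem_B g List.mem_cons_self] at hi
  obtain ⟨⟨g', hg', hu⟩, -⟩ := (h.mem i).1 hj
  exact absurd (h.lt_of_mem hg') (by rw [hu, hi]; exact lt_irrefl _)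

/-- This turns the exponent of the traversal cost into a geometric quantity, the depth of the family
of intervals at `g.a`. -/
theorem length_insert (h : LoopInvariant u v pre (g :: gs) L) :
    g.B.length + L.length = (active u v g.a).card := by
  have : (g.B.reverse ++ L).toFinset = active u v g.a := by
    ext i
    rw [List.mem_toFinset, h.mem_insert]
    simp [active]
  rw [← this, List.toFinset_card_of_nodup h.nodup_insert]
  simp

theorem next (h : LoopInvariant u v pre (g :: gs) L) :
    LoopInvariant u v (pre ++ [g]) gs ((g.B.reverse ++ L).diff g.E) where
  pairwise := by simpa using h.pairwise
  mem_B g' hg' := h.mem_B g' (List.mem_cons_of_mem _ hg')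
  mem_E g' hg' := h.mem_E g' (List.mem_cons_of_mem _ hg')
  nodup_B g' hg' := h.nodup_B g' (List.mem_cons_of_mem _ hg')
  left_mem := by simpa using h.left_mem
  right_mem := by simpa using h.right_mem
  le := h.le
  nodup := h.nodup_insert.diff
  mem i := by
    rw [h.nodup_insert.mem_sdiff_iff, h.mem_E g List.mem_cons_self, List.mem_append,
      List.mem_reverse, h.mem_B g List.mem_cons_self, h.mem]
    -- An interval that begins at `g.a` cannot have ended in an earlier group, because its endpoints
    -- are in order.
    have key : u i = g.a → ∀ g' ∈ pre, g'.a ≠ v i := fun hu g' hg' hv =>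
      absurd (h.lt_of_mem hg') (by rw [← hu, hv]; exact not_lt.2 (h.le i))
    constructor
    · rintro ⟨hi | ⟨⟨g', hg', hu⟩, hv⟩, hne⟩
      · refine ⟨⟨g, by simp, hi.symm⟩, fun g' hg' => ?_⟩
        rcases List.mem_append.1 hg' with hm | hm
        · exact key hi g' hm
        · rw [List.mem_singleton.1 hm]; exact fun h' => hne h'.symm
      · refine ⟨⟨g', by simp [hg'], hu⟩, fun g'' hg'' => ?_⟩
        rcases List.mem_append.1 hg'' with hm | hm
        · exact hv g'' hm
        · rw [List.mem_singleton.1 hm]; exact fun h' => hne h'.symm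
    · rintro ⟨⟨g', hg', hu⟩, hv⟩
      refine ⟨?_, fun h' => hv g (by simp) h'.symm⟩
      rcases List.mem_append.1 hg' with hm | hm
      · exact Or.inr ⟨⟨g', hm, hu⟩, fun g'' hg'' => hv g'' (by simp [hg''])⟩
      · rw [List.mem_singleton.1 hm] at hu
        exact Or.inl hu.symm

end LoopInvariant

/-- Insertions and removals are charged to the endpoints recorded in the groups, not to `n` per
group; this keeps the factor in front of 2^w linear in `n`. The constant 44 is the 43 of a visit
plus one control step. -/
theorem time_mainLoop_le (lo up u v : Fin n → K) (w : ℕ) (hw : ∀ a, (active u v a).card ≤ w)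
    (pre gs : List (Group K n)) (p : List (Fin n) × Vars K) (h : LoopInvariant u v pre gs p.1) :
    (forLoop (visit lo up) p gs).time ≤
      2 ^ w * (44 * gs.length + 21 * (gs.map (fun g => g.B.length + g.E.length)).sum) + 1 := by
  induction gs generalizing pre p with
  | nil => simp [forLoop]
  | cons g gs ih =>
    have h₁ := time_visit_le lo up p g w (h.length_insert.trans_le (hw _))
    have h₂ := ih (pre ++ [g]) (visit lo up p g).val (by rw [val_visit_fst]; exact h.next)
    have h₃ : 1 ≤ 2 ^ w := Nat.one_le_two_pow
    simp only [forLoop, time_bind, time_tick, List.length_cons, List.map_cons, List.sum_cons]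
    nlinarith

theorem le_time_mainLoop (lo up u v : Fin n → K)
    (pre gs : List (Group K n)) (p : List (Fin n) × Vars K) (h : LoopInvariant u v pre gs p.1)
    (g : Group K n) (hg : g ∈ gs) :
    2 ^ (active u v g.a).card ≤ (forLoop (visit lo up) p gs).time := by
  induction gs generalizing pre p with
  | nil => simp at hg
  | cons g' gs ih =>
    simp only [forLoop, time_bind, time_tick]
    rcases List.mem_cons.1 hg with rfl | hg
    · have := le_time_visit lo up p g
      rw [h.length_insert] at this
      omega
    · have := ih (pre ++ [g']) (visit lo up p g').val (by rw [val_visit_fst]; exact h.next) hg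
      omega

/-! ### The list of endpoints -/

/-- The right (`b = true`) or left (`b = false`) endpoint of the `i`th narrowed interval. -/
def endValue (lo up : Fin n → K) (i : Fin n) (b : Bool) : K :=
  if b then (lo i + up i) / 2 + (up i - lo i) / 2 / (n : K)
  else (lo i + up i) / 2 - (up i - lo i) / 2 / (n : K)

theorem val_addEndpoints (lo up : Fin n → K) (l : List (Endpoint K n)) (i : Fin n) :
    (addEndpoints lo up l i).val =
      ⟨endValue lo up i false, i, false⟩ :: ⟨endValue lo up i true, i, true⟩ :: l := rfl

theorem length_endpoints (lo up : Fin n → K) (acc : List (Endpoint K n)) (l : List (Fin n)) :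
    (forLoop (addEndpoints lo up) acc l).val.length = acc.length + 2 * l.length := by
  induction l generalizing acc with
  | nil => simp [forLoop]
  | cons i l ih =>
    simp only [forLoop, val_bind, ih, val_addEndpoints, List.length_cons]
    ring

theorem mem_endpoints (lo up : Fin n → K) (acc : List (Endpoint K n)) (l : List (Fin n))
    (e : Endpoint K n) :
    e ∈ (forLoop (addEndpoints lo up) acc l).val ↔
      e ∈ acc ∨ e.index ∈ l ∧ e.value = endValue lo up e.index e.isRight := by
  induction l generalizing acc with
  | nil => simp [forLoop]
  | cons i l ih =>
    simp only [forLoop, val_bind, ih, val_addEndpoints, List.mem_cons]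
    rcases e with ⟨a, j, b⟩
    cases b <;> simp only [Endpoint.mk.injEq, Bool.false_eq_true, Bool.true_eq_false, and_true,
      and_false, false_or]
    · constructor
      · rintro ((⟨rfl, rfl⟩ | h) | h)
        · simp
        · exact Or.inl h
        · exact Or.inr ⟨Or.inr h.1, h.2⟩
      · rintro (h | ⟨rfl | h, h'⟩)
        · exact Or.inl (Or.inr h)
        · exact Or.inl (Or.inl ⟨h', rfl⟩)
        · exact Or.inr ⟨h, h'⟩
    · constructor
      · rintro ((⟨rfl, rfl⟩ | h) | h)
        · simp
        · exact Or.inl h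
        · exact Or.inr ⟨Or.inr h.1, h.2⟩
      · rintro (h | ⟨rfl | h, h'⟩)
        · exact Or.inl (Or.inr h)
        · exact Or.inl (Or.inl ⟨h', rfl⟩)
        · exact Or.inr ⟨h, h'⟩

theorem nodup_endpoints (lo up : Fin n → K) (acc : List (Endpoint K n)) (l : List (Fin n))
    (hacc : acc.Nodup) (hl : l.Nodup) (h : ∀ e ∈ acc, e.index ∉ l) :
    (forLoop (addEndpoints lo up) acc l).val.Nodup := by
  induction l generalizing acc with
  | nil => simpa [forLoop] using hacc
  | cons i l ih =>
    obtain ⟨hi, hl'⟩ := List.nodup_cons.1 hl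
    simp only [forLoop, val_bind, val_addEndpoints]
    refine ih _ ?_ hl' ?_
    · have hn : ∀ a b, (⟨a, i, b⟩ : Endpoint K n) ∉ acc := fun a b hm =>
        h _ hm List.mem_cons_self
      simp [hn, hacc]
    · intro e he
      rcases List.mem_cons.1 he with rfl | he
      · exact hi
      · rcases List.mem_cons.1 he with rfl | he
        · exact hi
        · exact fun hm => h e he (List.mem_cons_of_mem _ hm)

/-- The sorted list of all endpoints. -/
def sortedEndpoints (lo up : Fin n → K) : List (Endpoint K n) :=
  let l := (forLoop (addEndpoints lo up) [] (List.finRange n)).val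
  (mergeSort l.length l).val

theorem length_sortedEndpoints (lo up : Fin n → K) :
    (sortedEndpoints lo up).length = 2 * n := by
  rw [sortedEndpoints, (perm_mergeSort _ _).length_eq, length_endpoints]
  simp

theorem mem_sortedEndpoints (lo up : Fin n → K) (e : Endpoint K n) :
    e ∈ sortedEndpoints lo up ↔ e.value = endValue lo up e.index e.isRight := by
  rw [sortedEndpoints, (perm_mergeSort _ _).mem_iff, mem_endpoints]
  simp

theorem loopInvariant_init (lo up : Fin n → K)
    (h : ∀ i, endValue lo up i false ≤ endValue lo up i true) :
    LoopInvariant (endValue lo up · false) (endValue lo up · true) []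
      (collect (sortedEndpoints lo up)).val [] := by
  have hs : (sortedEndpoints lo up).Pairwise (fun e e' => e.value ≤ e'.value) :=
    pairwise_mergeSort _ _ le_rfl
  have hn : (sortedEndpoints lo up).Nodup :=
    (perm_mergeSort _ _).nodup_iff.2
      (nodup_endpoints lo up [] _ List.nodup_nil (List.nodup_finRange n) (by simp))
  obtain ⟨h₁, h₂, h₃, h₄⟩ := collect_spec _ hs
  refine ⟨h₁, ?_, ?_, nodup_collect _ hs hn, ?_, ?_, h, List.nodup_nil, by simp⟩
  · intro g hg i
    have := h₂ g hg i false
    rw [mem_sortedEndpoints] at this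
    exact this.trans eq_comm
  · intro g hg i
    have := h₂ g hg i true
    rw [mem_sortedEndpoints] at this
    exact this.trans eq_comm
  · intro i
    exact h₃ ⟨endValue lo up i false, i, false⟩ ((mem_sortedEndpoints lo up _).2 rfl)
  · intro i
    exact h₃ ⟨endValue lo up i true, i, true⟩ ((mem_sortedEndpoints lo up _).2 rfl)

/-- The values of `V₁`, `V₂` and `M` before the main loop. -/
def initVars (up : Fin n → K) : Vars K :=
  let V₁ := (forLoop (addUpperSq up) 0 (List.finRange n)).val / (n : K)
  let V₂ := (forLoop (addUpper up) 0 (List.finRange n)).val / (n : K)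
  ⟨V₁, V₂, V₁ - V₂ * V₂⟩

/-- The running time splits into the preparation and the main loop. -/
theorem runningTime_eq (lo up : Fin n → K) :
    runningTime lo up =
      (forLoop (addEndpoints lo up) [] (List.finRange n)).time +
      (mergeSort (2 * n) (forLoop (addEndpoints lo up) [] (List.finRange n)).val).time +
      (collect (sortedEndpoints lo up)).time +
      (forLoop (addUpperSq up) 0 (List.finRange n)).time +
      (forLoop (addUpper up) 0 (List.finRange n)).time + 5 +
      (forLoop (visit lo up) ([], initVars up) (collect (sortedEndpoints lo up)).val).time := by
  rw [← length_sortedEndpoints lo up, sortedEndpoints, (perm_mergeSort _ _).length_eq]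
  simp only [runningTime, fgkla, initVars, time_bind, time_op, val_op, time_pure]
  ring

/-- There are at most 2n groups and exactly 2n recorded endpoints, so the main loop contributes
44·2n + 21·2n = 130n times 2^w. The linear part of the preparation is 45n, and 130 + 45 = 175. -/
theorem runningTime_le (lo up : Fin n → K)
    (h : ∀ i, endValue lo up i false ≤ endValue lo up i true) (w : ℕ)
    (hw : ∀ a, (active (endValue lo up · false) (endValue lo up · true) a).card ≤ w) :
    runningTime lo up ≤ 10 * n * Nat.clog 2 (2 * n) + 175 * n * 2 ^ w + 11 := by
  have hv := runningTime_eq lo up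
  have h₁ := time_forLoop_le (addEndpoints lo up) 15 (List.finRange n)
    (fun s a _ => (time_addEndpoints lo up s a).le) []
  have h₂ := time_mergeSort_le (2 * n) (forLoop (addEndpoints lo up) [] (List.finRange n)).val
  have h₃ := time_collect_le (sortedEndpoints lo up)
  have h₄ := time_forLoop_le (addUpperSq up) 3 (List.finRange n) (fun _ _ _ => le_rfl) 0
  have h₅ := time_forLoop_le (addUpper up) 2 (List.finRange n) (fun _ _ _ => le_rfl) 0
  have h₆ := time_mainLoop_le lo up _ _ w hw [] _ ([], initVars up) (loopInvariant_init lo up h)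
  rw [sum_collect, length_sortedEndpoints] at h₆
  have h₇ := length_collect_le (sortedEndpoints lo up)
  rw [length_sortedEndpoints] at h₃ h₇
  rw [length_endpoints] at h₂
  simp only [List.length_finRange, List.length_nil, zero_add] at h₁ h₂ h₄ h₅
  have h₈ : 2 ^ w * (44 * (collect (sortedEndpoints lo up)).val.length + 21 * (2 * n)) ≤
      2 ^ w * (130 * n) := Nat.mul_le_mul_left _ (by omega)
  have h₉ : 1 * (45 * n) ≤ 2 ^ w * (45 * n) := Nat.mul_le_mul_right _ Nat.one_le_two_pow
  rw [hv]
  have e₁ : 5 * (2 * n) * Nat.clog 2 (2 * n) = 10 * n * Nat.clog 2 (2 * n) := by ring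
  have e₂ : 175 * n * 2 ^ w = 2 ^ w * (130 * n) + 2 ^ w * (45 * n) := by ring
  rw [e₁] at h₂
  rw [e₂]
  omega

/-- Every left endpoint is the value of some group, and the visit of that group alone takes this
long. -/
theorem le_runningTime (lo up : Fin n → K)
    (h : ∀ i, endValue lo up i false ≤ endValue lo up i true) (i : Fin n) :
    2 ^ (active (endValue lo up · false) (endValue lo up · true)
      (endValue lo up i false)).card ≤ runningTime lo up := by
  have hv := runningTime_eq lo up
  have hI := loopInvariant_init lo up h
  obtain ⟨g, hg, ha⟩ := hI.left_mem i
  have := le_time_mainLoop lo up _ _ [] _ ([], initVars up) hI g hg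
  rw [← ha]
  omega

end Groups

/-! ### The clique number -/

section Clique

variable {n : ℕ} {lo up : Fin n → ℝ}

theorem narrowed_eq (i : Fin n) :
    narrowed lo up i = Set.Icc (endValue lo up i false) (endValue lo up i true) := by
  simp only [narrowed, endValue, center, radius]
  congr 1 <;> simp <;> ring

theorem endValue_le (h : lo ≤ up) (i : Fin n) :
    endValue lo up i false ≤ endValue lo up i true := by
  have h₁ : 0 ≤ (up i - lo i) / 2 / (n : ℝ) :=
    div_nonneg (div_nonneg (sub_nonneg.2 (h i)) (by norm_num)) (Nat.cast_nonneg n)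
  simp only [endValue]
  simp
  linarith

theorem card_active_le_omega (a : ℝ) :
    (active (endValue lo up · false) (endValue lo up · true) a).card ≤ omega lo up := by
  refine SimpleGraph.IsClique.card_le_cliqueNum (G := intersectionGraph lo up) (tc := ?_)
  intro i hi j hj hij
  simp only [active, Finset.coe_filter, Finset.mem_univ, true_and, Set.mem_ofPred_eq] at hi hj
  exact ⟨hij, a, by rw [narrowed_eq]; exact hi, by rw [narrowed_eq]; exact hj⟩

theorem exists_omega_clique (lo up : Fin n → ℝ) :
    ∃ S : Finset (Fin n), S.card = omega lo up ∧
      ∀ i ∈ S, ∀ j ∈ S, i ≠ j → (narrowed lo up i ∩ narrowed lo up j).Nonempty := by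
  obtain ⟨S, hS⟩ := (intersectionGraph lo up).exists_isNClique_cliqueNum
  exact ⟨S, hS.card_eq, fun i hi j hj hij => (hS.isClique hi hj hij).2⟩

theorem two_pow_omega_le_runningTime (h : lo ≤ up) :
    2 ^ omega lo up ≤ runningTime lo up := by
  obtain ⟨S, hS, hc⟩ := exists_omega_clique lo up
  rcases S.eq_empty_or_nonempty with rfl | hne
  · rw [← hS]
    have hv := runningTime_eq lo up
    simp
    omega
  -- Helly's theorem on the line: the rightmost left endpoint of a clique belongs to every member,
  -- since each member meets the interval that begins there.
  · obtain ⟨i, hi, hmax⟩ := S.exists_max_image (endValue lo up · false) hne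
    refine le_trans (Nat.pow_le_pow_right (by norm_num) ?_) (le_runningTime lo up (endValue_le h) i)
    rw [← hS]
    refine Finset.card_le_card fun j hj => ?_
    simp only [active, Finset.mem_filter, Finset.mem_univ, true_and]
    refine ⟨hmax j hj, ?_⟩
    rcases eq_or_ne i j with rfl | hij
    · exact endValue_le h i
    · obtain ⟨x, hx₁, hx₂⟩ := hc i hi j hj hij
      rw [narrowed_eq] at hx₁ hx₂
      exact hx₁.1.trans hx₂.2

theorem runningTime_le_omega (h : lo ≤ up) :
    runningTime lo up ≤ 10 * n * Nat.clog 2 (2 * n) + 175 * n * 2 ^ omega lo up + 11 :=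
  runningTime_le lo up (endValue_le h) _ card_active_le_omega

end Clique

/-! ### The running time depends only on the order of the endpoints -/

section OrderPattern

variable {K : Type} [Field K] [LinearOrder K] {n : ℕ}

/-- `e` and `e'` are the same endpoint for the values `f` and `f'`. -/
structure Endpoint.Rel (f f' : Fin n → Bool → K) (e e' : Endpoint K n) : Prop where
  index : e.index = e'.index
  isRight : e.isRight = e'.isRight
  value_left : e.value = f e.index e.isRight
  value_right : e'.value = f' e.index e.isRight

/-- `g` and `g'` record the same indices, and their values are the same endpoint. -/
structure Group.Rel (f f' : Fin n → Bool → K) (g g' : Group K n) : Prop where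
  B : g.B = g'.B
  E : g.E = g'.E
  value : ∃ i b, g.a = f i b ∧ g'.a = f' i b

variable {f f' : Fin n → Bool → K}

theorem split_rel {α : Type} {R : α → α → Prop} {l l' : List α} (h : List.Forall₂ R l l') :
    List.Forall₂ R (split l).val.1 (split l').val.1 ∧
    List.Forall₂ R (split l).val.2 (split l').val.2 := by
  induction h with
  | nil => simp [split]
  | cons hab _ ih => exact ⟨List.Forall₂.cons hab ih.2, ih.1⟩

theorem merge_rel (hf : ∀ i b j c, f i b ≤ f j c ↔ f' i b ≤ f' j c)
    (l₁ l₂ l₁' l₂' : List (Endpoint K n))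
    (h₁ : List.Forall₂ (Endpoint.Rel f f') l₁ l₁') (h₂ : List.Forall₂ (Endpoint.Rel f f') l₂ l₂') :
    List.Forall₂ (Endpoint.Rel f f') (merge l₁ l₂).val (merge l₁' l₂').val ∧
      (merge l₁ l₂).time = (merge l₁' l₂').time := by
  fun_induction merge l₁ l₂ generalizing l₁' l₂' with
  | case1 l₂ =>
    cases h₁
    rw [merge]
    exact ⟨h₂, rfl⟩
  | case2 e₁ l₁ =>
    cases h₂
    cases h₁ with
    | cons he hl =>
      rw [merge]
      exact ⟨List.Forall₂.cons he hl, rfl⟩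
  | case3 e₁ l₁ e₂ l₂ ih₁ ih₂ =>
    cases h₁ with
    | @cons _ e₁' _ l₁' he₁ hl₁ =>
    cases h₂ with
    | @cons _ e₂' _ l₂' he₂ hl₂ =>
    have hle : e₁.value ≤ e₂.value ↔ e₁'.value ≤ e₂'.value := by
      rw [he₁.value_left, he₂.value_left, he₁.value_right, he₂.value_right]
      exact hf _ _ _ _
    rw [merge]
    by_cases h : e₁.value ≤ e₂.value
    · obtain ⟨i₁, i₂⟩ := ih₁ _ _ hl₁ (List.Forall₂.cons he₂ hl₂)
      simp only [val_bind, time_bind, val_op, time_op, h, hle.1 h, decide_true, if_true, i₂]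
      exact ⟨List.Forall₂.cons he₁ i₁, trivial⟩
    · obtain ⟨i₁, i₂⟩ := ih₂ _ _ (List.Forall₂.cons he₁ hl₁) hl₂
      simp only [val_bind, time_bind, val_op, time_op, h, mt hle.2 h, decide_false,
        Bool.false_eq_true, if_false, i₂]
      exact ⟨List.Forall₂.cons he₂ i₁, trivial⟩

theorem mergeSort_rel (hf : ∀ i b j c, f i b ≤ f j c ↔ f' i b ≤ f' j c) (d : ℕ)
    (l l' : List (Endpoint K n)) (h : List.Forall₂ (Endpoint.Rel f f') l l') :
    List.Forall₂ (Endpoint.Rel f f') (mergeSort d l).val (mergeSort d l').val ∧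
      (mergeSort d l).time = (mergeSort d l').time := by
  induction d generalizing l l' with
  | zero => exact ⟨by simpa [mergeSort] using h, by simp [mergeSort]⟩
  | succ d ih =>
    have hs := split_rel h
    have ht : (split l).time = (split l').time := by
      rw [time_split_le, time_split_le, h.length_eq]
    cases h with
    | nil => simp [mergeSort]
    | cons h₁ h =>
      cases h with
      | nil => simp [mergeSort, h₁]
      | cons h₂ h =>
        obtain ⟨a₁, a₂⟩ := ih _ _ hs.1
        obtain ⟨b₁, b₂⟩ := ih _ _ hs.2
        obtain ⟨c₁, c₂⟩ := merge_rel hf _ _ _ _ a₁ b₁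
        simp only [mergeSort, val_bind, time_bind, a₂, b₂, c₂, ht]
        exact ⟨c₁, trivial⟩

theorem addToGroup_rel {e e' : Endpoint K n} {g g' : Group K n} (he : e.Rel f f' e')
    (hg : g.Rel f f' g') : (addToGroup e g).val.Rel f f' (addToGroup e' g').val := by
  rcases e with ⟨a, i, b⟩
  rcases e' with ⟨a', i', b'⟩
  obtain ⟨rfl, rfl, -, -⟩ := he
  obtain ⟨h₁, h₂, h₃⟩ := hg
  cases b
  · exact ⟨by simp [addToGroup, h₁], by simp [addToGroup, h₂], by simpa [addToGroup] using h₃⟩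
  · exact ⟨by simp [addToGroup, h₁], by simp [addToGroup, h₂], by simpa [addToGroup] using h₃⟩

theorem collect_rel (hf : ∀ i b j c, f i b ≤ f j c ↔ f' i b ≤ f' j c)
    (l l' : List (Endpoint K n)) (h : List.Forall₂ (Endpoint.Rel f f') l l') :
    List.Forall₂ (Group.Rel f f') (collect l).val (collect l').val ∧
      (collect l).time = (collect l').time := by
  induction h with
  | nil => simp [collect]
  | @cons e e' l l' he hl ih =>
    obtain ⟨i₁, i₂⟩ := ih
    have hnew : Group.Rel f f' ⟨e.value, [], []⟩ ⟨e'.value, [], []⟩ :=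
      ⟨rfl, rfl, _, _, he.value_left, he.value_right⟩
    simp only [collect, val_bind, time_bind, i₂]
    rcases hc : (collect l).val with _ | ⟨g, gs⟩ <;> rcases hc' : (collect l').val with _ | ⟨g', gs'⟩
    · simp [time_addToGroup, addToGroup_rel he hnew]
    · rw [hc, hc'] at i₁; cases i₁
    · rw [hc, hc'] at i₁; cases i₁
    · rw [hc, hc'] at i₁
      obtain ⟨hg, hgs⟩ := List.forall₂_cons.1 i₁
      have heq : e.value = g.a ↔ e'.value = g'.a := by
        obtain ⟨i, b, hi, hi'⟩ := hg.value
        rw [he.value_left, he.value_right, hi, hi', le_antisymm_iff, le_antisymm_iff, hf, hf]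
      by_cases h : e.value = g.a
      · simp only [h, heq.1 h, decide_true, if_true, val_bind, time_bind, val_op, time_op,
          time_addToGroup]
        exact ⟨List.Forall₂.cons (addToGroup_rel he hg) hgs, trivial⟩
      · simp only [h, mt heq.2 h, decide_false, Bool.false_eq_true, if_false, val_bind, time_bind,
          val_op, time_op, time_addToGroup]
        exact ⟨List.Forall₂.cons (addToGroup_rel he hnew) i₁, trivial⟩

theorem addEndpoints_rel (lo up lo' up' : Fin n → K) (l : List (Fin n))
    (acc acc' : List (Endpoint K n))
    (h : List.Forall₂ (Endpoint.Rel (endValue lo up) (endValue lo' up')) acc acc') :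
    List.Forall₂ (Endpoint.Rel (endValue lo up) (endValue lo' up'))
      (forLoop (addEndpoints lo up) acc l).val (forLoop (addEndpoints lo' up') acc' l).val ∧
    (forLoop (addEndpoints lo up) acc l).time = (forLoop (addEndpoints lo' up') acc' l).time := by
  induction l generalizing acc acc' with
  | nil => exact ⟨h, rfl⟩
  | cons i l ih =>
    obtain ⟨h₁, h₂⟩ := ih (addEndpoints lo up acc i).val (addEndpoints lo' up' acc' i).val (by
      rw [val_addEndpoints, val_addEndpoints]
      exact .cons ⟨rfl, rfl, rfl, rfl⟩ (.cons ⟨rfl, rfl, rfl, rfl⟩ h))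
    simp only [forLoop, val_bind, time_bind, h₂, time_addEndpoints]
    exact ⟨h₁, trivial⟩

/-- The branches of a pass read only the bits, and `switch` costs the same for all numbers; the
signs and the variables have no influence on the time. -/
theorem advance_congr (lo up lo' up' : Fin n → K) (l l' : List (Cell K n)) (v v' : Vars K)
    (h : l.map Cell.z = l'.map Cell.z) :
    (advance lo up l v).val.1.map Cell.z = (advance lo' up' l' v').val.1.map Cell.z ∧
      (advance lo up l v).time = (advance lo' up' l' v').time := by
  fun_induction advance lo up l v generalizing l' v' with
  | case1 =>
    obtain rfl : l' = [] := by simpa using h.symm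
    simp [advance]
  | case2 v c =>
    obtain ⟨c', rfl⟩ : ∃ c', l' = [c'] := by
      rcases l' with _ | ⟨c', _ | ⟨d', l'⟩⟩ <;> simp at h ⊢
    simp [advance, time_switch]
  | case3 c d l v ih =>
    obtain ⟨c', d', l', rfl⟩ : ∃ c' d' m', l' = c' :: d' :: m' := by
      rcases l' with _ | ⟨c', _ | ⟨d', l'⟩⟩ <;> simp at h ⊢
    simp only [List.map_cons, List.cons.injEq] at h
    have ih' := ih (d' :: l') v' (by simp [h])
    rw [advance]
    by_cases hz : c.z = true
    · have hz' : c'.z = true := h.1 ▸ hz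
      simp [hz, hz', ih']
    · have hz' : ¬ c'.z = true := h.1 ▸ hz
      simp [hz, hz', time_switch, h]

theorem time_whileLoop_advance_congr (lo up lo' up' : Fin n → K) (N : ℕ)
    (p p' : List (Cell K n) × Vars K) (h : p.1.map Cell.z = p'.1.map Cell.z) :
    (whileLoop (fun p => advance lo up p.1 p.2) N p).time =
      (whileLoop (fun p => advance lo' up' p.1 p.2) N p').time := by
  induction N generalizing p p' with
  | zero => rfl
  | succ N ih =>
    obtain ⟨h₁, h₂⟩ := advance_congr lo up lo' up' p.1 p'.1 p.2 p'.2 h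
    simp only [whileLoop, time_bind, h₂, ih _ _ h₁]

theorem time_traverse_congr (lo up lo' up' : Fin n → K) (L : List (Fin n)) (v v' : Vars K) :
    (traverse lo up L v).time = (traverse lo' up' L v').time := by
  have h := time_whileLoop_advance_congr lo up lo' up' (twoPow L).val
    ((initCells L).val, v) ((initCells L).val, v') rfl
  simp only [traverse, time_bind, time_pure, h]

theorem time_fixLoop_congr (lo up lo' up' : Fin n → K) (E : List (Fin n))
    (p p' : List (Fin n) × Vars K) (h : p.1 = p'.1) :
    (forLoop (fixIndex lo up) p E).time = (forLoop (fixIndex lo' up') p' E).time := by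
  induction E generalizing p p' with
  | nil => rfl
  | cons i E ih =>
    have h₁ : (fixIndex lo up p i).time = (fixIndex lo' up' p' i).time := by
      change (removeIndex i p.1).time + 16 = (removeIndex i p'.1).time + 16
      rw [h]
    have h₂ : (fixIndex lo up p i).val.1 = (fixIndex lo' up' p' i).val.1 := by
      rw [val_fixIndex_fst, val_fixIndex_fst, h]
    simp only [forLoop, time_bind, h₁, ih _ _ h₂]

theorem time_mainLoop_congr (lo up lo' up' : Fin n → K) (gs gs' : List (Group K n))
    (p p' : List (Fin n) × Vars K) (hp : p.1 = p'.1) (h : List.Forall₂ (Group.Rel f f') gs gs') :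
    (forLoop (visit lo up) p gs).time = (forLoop (visit lo' up') p' gs').time := by
  induction h generalizing p p' with
  | nil => rfl
  | @cons g g' gs gs' hg _ ih =>
    have h₁ : (visit lo up p g).time = (visit lo' up' p' g').time := by
      simp only [visit, time_bind, hg.B, hg.E, hp]
      rw [time_traverse_congr lo up lo' up' _ p.2 p'.2]
      congr 2
      exact time_fixLoop_congr lo up lo' up' _ _ _ rfl
    have h₂ : (visit lo up p g).val.1 = (visit lo' up' p' g').val.1 := by
      rw [val_visit_fst, val_visit_fst, hg.B, hg.E, hp]
    simp only [forLoop, time_bind, h₁, ih _ _ h₂]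

theorem time_forLoop_of_const {σ α : Type} (f : σ → α → Timed σ) (c : ℕ)
    (h : ∀ s a, (f s a).time = c) (l : List α) (s : σ) :
    (forLoop f s l).time = l.length * (c + 1) + 1 := by
  induction l generalizing s with
  | nil => simp [forLoop]
  | cons a l ih =>
    simp only [forLoop, time_bind, time_tick, List.length_cons, ih, h]
    ring

/-- The numbers enter the control flow only through comparisons of endpoints in `merge` and
`collect`; the maximum taken in `switch` costs one step whatever its outcome. -/
theorem runningTime_congr (lo up lo' up' : Fin n → K)
    (hf : ∀ i b j c, endValue lo up i b ≤ endValue lo up j c ↔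
      endValue lo' up' i b ≤ endValue lo' up' j c) :
    runningTime lo up = runningTime lo' up' := by
  obtain ⟨a₁, a₂⟩ := addEndpoints_rel lo up lo' up' (List.finRange n) [] [] .nil
  obtain ⟨b₁, b₂⟩ := mergeSort_rel hf (2 * n) _ _ a₁
  have hs : ∀ lo up : Fin n → K, sortedEndpoints lo up =
      (mergeSort (2 * n) (forLoop (addEndpoints lo up) [] (List.finRange n)).val).val := by
    intro lo up
    simp [sortedEndpoints, length_endpoints]
  rw [← hs, ← hs] at b₁
  obtain ⟨c₁, c₂⟩ := collect_rel hf _ _ b₁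
  rw [runningTime_eq, runningTime_eq, a₂, b₂, c₂,
    time_mainLoop_congr lo up lo' up' _ _ ([], initVars up) ([], initVars up') rfl c₁,
    time_forLoop_of_const (addUpperSq up) 3 (fun _ _ => rfl),
    time_forLoop_of_const (addUpperSq up') 3 (fun _ _ => rfl),
    time_forLoop_of_const (addUpper up) 2 (fun _ _ => rfl),
    time_forLoop_of_const (addUpper up') 2 (fun _ _ => rfl)]

theorem omega_congr (lo up lo' up' : Fin n → ℝ)
    (hf : ∀ i b j c, endValue lo up i b ≤ endValue lo up j c ↔
      endValue lo' up' i b ≤ endValue lo' up' j c) :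
    omega lo up = omega lo' up' := by
  have : intersectionGraph lo up = intersectionGraph lo' up' := by
    ext i j
    simp only [intersectionGraph, narrowed_eq, Set.Icc_inter_Icc, Set.nonempty_Icc, sup_le_iff,
      le_inf_iff, hf]
  rw [omega, omega, this]

end OrderPattern

/-! ### Measurability -/

section Measurability

variable {Ω : Type*} [MeasurableSpace Ω] {n : ℕ}

/-- Such a function factors through the table of all comparisons between endpoints. The table is a
measurable map into a finite space, on which every function is measurable. -/
theorem measurable_of_orderPattern {F : (Fin n → ℝ) → (Fin n → ℝ) → ℕ}
    (hF : ∀ lo up lo' up' : Fin n → ℝ, (∀ i b j c, endValue lo up i b ≤ endValue lo up j c ↔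
      endValue lo' up' i b ≤ endValue lo' up' j c) → F lo up = F lo' up')
    {lo up : Ω → Fin n → ℝ} (hlo : ∀ i, Measurable fun w => lo w i)
    (hup : ∀ i, Measurable fun w => up w i) : Measurable fun w => F (lo w) (up w) := by
  classical
  have he : ∀ i b, Measurable fun w => endValue (lo w) (up w) i b := by
    intro i b
    have := hlo i
    have := hup i
    unfold endValue
    split_ifs <;> fun_prop
  let pat : Ω → (Fin n × Bool) × (Fin n × Bool) → Prop := fun w k =>
    endValue (lo w) (up w) k.1.1 k.1.2 ≤ endValue (lo w) (up w) k.2.1 k.2.2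
  have hpat : Measurable pat := by
    refine measurable_pi_iff.2 fun k => ?_
    exact measurableSet_setOfPred.1 (measurableSet_le (he _ _) (he _ _))
  have hfac : (fun w => F (lo w) (up w)).FactorsThrough pat := by
    intro w w' h
    exact hF _ _ _ _ fun i b j c => iff_of_eq (congrFun h ((i, b), (j, c)))
  have : (fun w => F (lo w) (up w)) =
      Function.extend pat (fun w => F (lo w) (up w)) (fun _ => 0) ∘ pat :=
    (hfac.extend_comp _).symm
  rw [this]
  exact (measurable_of_finite _).comp hpat

variable {xc xr : Fin n → Ω → ℝ}

theorem measurable_randomTime (hc : ∀ i, Measurable (xc i)) (hr : ∀ i, Measurable (xr i)) :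
    Measurable (randomTime xc xr) :=
  measurable_of_orderPattern runningTime_congr (fun i => (hc i).sub (hr i))
    (fun i => (hc i).add (hr i))

theorem measurable_randomOmega (hc : ∀ i, Measurable (xc i)) (hr : ∀ i, Measurable (xr i)) :
    Measurable (randomOmega xc xr) :=
  measurable_of_orderPattern omega_congr (fun i => (hc i).sub (hr i))
    (fun i => (hc i).add (hr i))

end Measurability

open scoped ENNReal

/-! ### The moments of the clique number -/

section CliqueMoment

theorem endValue_center_radius {n : ℕ} (x r : Fin n → ℝ) (i : Fin n) (b : Bool) :
    endValue (fun i => x i - r i) (fun i => x i + r i) i b =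
      if b then x i + r i / n else x i - r i / n := by
  simp only [endValue]
  split_ifs <;> ring

/-- The summand of the clique member with least radius already dominates Q^ω: each other member
contributes a factor Q, and the factor in front accounts for that member itself. Which index it is
depends on the sample, so all are summed. -/
theorem pow_omega_le {m Q : ℕ} (hQ : 1 ≤ Q) (x r : Fin (m + 1) → ℝ) :
    Q ^ omega (fun i => x i - r i) (fun i => x i + r i) ≤
      Q * ∑ i, ∏ k, if |x i - x (Fin.succAbove i k)| ≤ 2 / (m + 1) * r (Fin.succAbove i k)
        then Q else 1 := by
  obtain ⟨S, hS, hc⟩ := exists_omega_clique (fun i => x i - r i) (fun i => x i + r i)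
  rw [← hS]
  have hone : ∀ i, 1 ≤ ∏ k : Fin m,
      if |x i - x (Fin.succAbove i k)| ≤ 2 / (m + 1) * r (Fin.succAbove i k) then Q else 1 :=
    fun i => Finset.one_le_prod' fun k _ => by split_ifs <;> omega
  rcases S.eq_empty_or_nonempty with rfl | hne
  · rw [Finset.card_empty, pow_zero]
    refine Nat.mul_pos hQ (lt_of_lt_of_le (hone 0) ?_)
    exact Finset.single_le_sum (f := fun i => ∏ k : Fin m,
      if |x i - x (Fin.succAbove i k)| ≤ 2 / (m + 1) * r (Fin.succAbove i k) then Q else 1)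
      (fun i _ => Nat.zero_le _) (Finset.mem_univ 0)
  -- Intersection gives |x_i - x_j| ≤ (r_i + r_j)/n, and minimality of r_i replaces this by 2r_j/n.
  -- Without r_i, the conditions for different j share only x_i.
  · obtain ⟨i, hi, hmin⟩ := S.exists_min_image r hne
    have hcard : S.card ≤ 1 + (Finset.univ.filter fun k : Fin m =>
        |x i - x (Fin.succAbove i k)| ≤ 2 / (m + 1) * r (Fin.succAbove i k)).card := by
      rw [← Finset.card_erase_add_one hi, add_comm,
        ← Finset.card_map (Fin.succAboveEmb i)]
      refine Nat.add_le_add_left (Finset.card_le_card fun j hj => ?_) 1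
      obtain ⟨hji, hjS⟩ := Finset.mem_erase.1 hj
      obtain ⟨k, rfl⟩ := Fin.exists_succAbove_eq hji
      refine Finset.mem_map.2 ⟨k, Finset.mem_filter.2 ⟨Finset.mem_univ _, ?_⟩, rfl⟩
      obtain ⟨y, hy₁, hy₂⟩ := hc i hi _ hjS hji.symm
      rw [narrowed_eq, endValue_center_radius, endValue_center_radius] at hy₁ hy₂
      simp only [Bool.false_eq_true, if_false, if_true, Set.mem_Icc, Nat.cast_add,
        Nat.cast_one] at hy₁ hy₂
      have hr : r i / (m + 1 : ℝ) ≤ r (Fin.succAbove i k) / (m + 1 : ℝ) :=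
        div_le_div_of_nonneg_right (hmin _ hjS) (by positivity)
      have h2 : 2 / (m + 1 : ℝ) * r (Fin.succAbove i k) =
        r (Fin.succAbove i k) / (m + 1 : ℝ) + r (Fin.succAbove i k) / (m + 1 : ℝ) := by ring
      rw [h2, abs_le]
      constructor <;> linarith [hy₁.1, hy₁.2, hy₂.1, hy₂.2]
    calc Q ^ S.card ≤ Q ^ (1 + (Finset.univ.filter fun k : Fin m =>
          |x i - x (Fin.succAbove i k)| ≤ 2 / (m + 1) * r (Fin.succAbove i k)).card) :=
          Nat.pow_le_pow_right hQ hcard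
      _ = Q * ∏ k : Fin m, if |x i - x (Fin.succAbove i k)| ≤
          2 / (m + 1) * r (Fin.succAbove i k) then Q else 1 := by
          rw [pow_add, pow_one, Finset.prod_ite, Finset.prod_const, Finset.prod_const_one, mul_one]
      _ ≤ _ := by
          refine Nat.mul_le_mul_left _ ?_
          exact Finset.single_le_sum (f := fun i => ∏ k : Fin m,
            if |x i - x (Fin.succAbove i k)| ≤ 2 / (m + 1) * r (Fin.succAbove i k) then Q else 1)
            (fun i _ => Nat.zero_le _) (Finset.mem_univ i)

/-- Injectivity of `φ` makes the factors depend on distinct, hence independent, coordinates. -/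
theorem lintegral_pi_prod_comp {m N : ℕ} (ν : Fin N → Measure ℝ) [∀ j, IsProbabilityMeasure (ν j)]
    (φ : Fin m → Fin N) (hφ : Function.Injective φ) (g : Fin m → ℝ → ℝ≥0∞)
    (hg : ∀ k, Measurable (g k)) :
    ∫⁻ x, ∏ k, g k (x (φ k)) ∂Measure.pi ν = ∏ k, ∫⁻ s, g k s ∂ν (φ k) := by
  have h₁ : iIndepFun (fun (j : Fin N) (x : Fin N → ℝ) => x j) (Measure.pi ν) :=
    iIndepFun_pi (X := fun _ => id) fun _ => aemeasurable_id
  have h₂ : iIndepFun (fun k (x : Fin N → ℝ) => g k (x (φ k))) (Measure.pi ν) :=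
    (h₁.precomp hφ).comp g hg
  rw [lintegral_prod_eq_prod_lintegral_of_indepFun Finset.univ _ h₂
    fun k => (hg k).comp (measurable_pi_apply _)]
  exact Finset.prod_congr rfl fun k _ =>
    (measurePreserving_eval ν (φ k)).lintegral_comp (hg k)

variable {Ω : Type*} [MeasurableSpace Ω] {P : Measure Ω} [IsProbabilityMeasure P]

/-- The expectation of `∏ j ≠ i, G (xc i) (xc j) (xr j)`, by Tonelli's theorem. -/
theorem lintegral_prod_le {m : ℕ} {xc xr : Fin (m + 1) → Ω → ℝ}
    (hc : ∀ i, Measurable (xc i)) (hr : ∀ i, Measurable (xr i))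
    (hci : iIndepFun xc P) (hri : iIndepFun xr P)
    (hcr : IndepFun (fun w i => xc i w) (fun w i => xr i w) P)
    (G : ℝ × ℝ × ℝ → ℝ≥0∞) (hG : Measurable G) (b : ℝ≥0∞)
    (hb : ∀ j t, ∫⁻ r, ∫⁻ s, G (t, s, r) ∂P.map (xc j) ∂P.map (xr j) ≤ b) (i : Fin (m + 1)) :
    ∫⁻ w, ∏ k, G (xc i w, xc (Fin.succAbove i k) w, xr (Fin.succAbove i k) w) ∂P ≤ b ^ m := by
  have : ∀ j, IsProbabilityMeasure (P.map (xc j)) := fun j =>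
    Measure.isProbabilityMeasure_map (hc j).aemeasurable
  have : ∀ j, IsProbabilityMeasure (P.map (xr j)) := fun j =>
    Measure.isProbabilityMeasure_map (hr j).aemeasurable
  have mc : Measurable fun w i => xc i w := measurable_pi_iff.2 hc
  have mr : Measurable fun w i => xr i w := measurable_pi_iff.2 hr
  have hmap : P.map (fun w => ((fun i => xc i w), fun i => xr i w)) =
      (Measure.pi fun j => P.map (xc j)).prod (Measure.pi fun j => P.map (xr j)) := by
    rw [hcr.map_prod_eq_prod_map_map mc.aemeasurable mr.aemeasurable,
      (iIndepFun_iff_map_fun_eq_pi_map fun j => (hc j).aemeasurable).1 hci,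
      (iIndepFun_iff_map_fun_eq_pi_map fun j => (hr j).aemeasurable).1 hri]
  have mF : Measurable fun p : (Fin (m + 1) → ℝ) × (Fin (m + 1) → ℝ) =>
      ∏ k, G (p.1 i, p.1 (Fin.succAbove i k), p.2 (Fin.succAbove i k)) :=
    Finset.measurable_prod _ fun k _ => hG.comp (by fun_prop)
  have mH : ∀ k, Measurable fun q : ℝ × ℝ =>
      ∫⁻ r, G (q.1, q.2, r) ∂P.map (xr (Fin.succAbove i k)) := fun k => by
    refine Measurable.lintegral_prod_right' (f := fun q : (ℝ × ℝ) × ℝ => G (q.1.1, q.1.2, q.2)) ?_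
    exact hG.comp (by fun_prop)
  have mK : Measurable fun q : ℝ × (Fin m → ℝ) =>
      ∏ k, ∫⁻ r, G (q.1, q.2 k, r) ∂P.map (xr (Fin.succAbove i k)) :=
    Finset.measurable_prod _ fun k _ =>
      (mH k).comp (by fun_prop : Measurable fun q : ℝ × (Fin m → ℝ) => (q.1, q.2 k))
  calc ∫⁻ w, ∏ k, G (xc i w, xc (Fin.succAbove i k) w, xr (Fin.succAbove i k) w) ∂P
      = ∫⁻ p, ∏ k, G (p.1 i, p.1 (Fin.succAbove i k), p.2 (Fin.succAbove i k))
          ∂(Measure.pi fun j => P.map (xc j)).prod (Measure.pi fun j => P.map (xr j)) := by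
        rw [← hmap, lintegral_map mF (mc.prodMk mr)]
    _ = ∫⁻ x, ∏ k, ∫⁻ r, G (x i, x (Fin.succAbove i k), r) ∂P.map (xr (Fin.succAbove i k))
          ∂Measure.pi fun j => P.map (xc j) := by
        rw [lintegral_prod _ mF.aemeasurable]
        refine lintegral_congr fun x => ?_
        exact lintegral_pi_prod_comp _ _ Fin.succAbove_right_injective
          (fun k r => G (x i, x (Fin.succAbove i k), r)) fun k => hG.comp (by fun_prop)
    -- The center of index `i` occurs in all factors; it is split off so that, for a fixed value
    -- `t`, the remaining factors are independent.
    _ = ∫⁻ q : ℝ × (Fin m → ℝ), ∏ k, ∫⁻ r, G (q.1, q.2 k, r) ∂P.map (xr (Fin.succAbove i k))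
          ∂(P.map (xc i)).prod (Measure.pi fun k => P.map (xc (Fin.succAbove i k))) := by
        rw [← (measurePreserving_piFinSuccAbove (fun j => P.map (xc j)) i).lintegral_comp mK]
        rfl
    _ = ∫⁻ t, ∏ k, ∫⁻ s, ∫⁻ r, G (t, s, r) ∂P.map (xr (Fin.succAbove i k))
          ∂P.map (xc (Fin.succAbove i k)) ∂P.map (xc i) := by
        rw [lintegral_prod _ mK.aemeasurable]
        refine lintegral_congr fun t => ?_
        exact lintegral_pi_prod_comp _ id Function.injective_id
          (fun k s => ∫⁻ r, G (t, s, r) ∂P.map (xr (Fin.succAbove i k)))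
          fun k => (mH k).comp (by fun_prop : Measurable fun s : ℝ => (t, s))
    _ ≤ ∫⁻ _, b ^ m ∂P.map (xc i) := by
        refine lintegral_mono fun t => ?_
        refine (Finset.prod_le_pow_card _ _ b fun k _ => ?_).trans_eq (by simp)
        -- The bound `hb` integrates over the center first, for a fixed radius.
        rw [lintegral_lintegral_swap]
        · exact hb _ t
        · exact (hG.comp (by fun_prop : Measurable fun p : ℝ × ℝ => (t, p.1, p.2))).aemeasurable
    _ = b ^ m := by simp

theorem measure_Icc_le {X : Ω → ℝ} (hX : Measurable X) {L : ℝ}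
    (hL : ∀ z z' : ℝ, z < z' → P.real {w | X w ≤ z'} - P.real {w | X w ≤ z} ≤ L * (z' - z))
    {a b : ℝ} (hab : a ≤ b) : P.map X (Set.Icc a b) ≤ ENNReal.ofReal (L * (b - a)) := by
  rw [Measure.map_apply hX measurableSet_Icc, ← ofReal_measureReal]
  refine ENNReal.ofReal_le_ofReal ?_
  -- The distribution function controls half-open intervals only. Enlarging to (a - d, b] includes
  -- the point `a`, and d → 0 removes the excess.
  have hd : ∀ d : ℝ, 0 < d → P.real (X ⁻¹' Set.Icc a b) ≤ L * (b - a) + L * d := by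
    intro d hd
    have hsub : {w | X w ≤ a - d} ⊆ {w | X w ≤ b} := fun w (hw : X w ≤ a - d) => by
      change X w ≤ b
      linarith
    have h₁ : P.real (X ⁻¹' Set.Icc a b) ≤ P.real ({w | X w ≤ b} \ {w | X w ≤ a - d}) := by
      refine measureReal_mono fun w hw => ⟨hw.2, fun h : X w ≤ a - d => ?_⟩
      have := hw.1
      linarith
    rw [measureReal_sdiff hsub (hX measurableSet_Iic)] at h₁
    have h₂ := hL (a - d) b (by linarith)
    linarith
  have hlim : Tendsto (fun d : ℝ => L * (b - a) + L * d) (nhdsWithin 0 (Set.Ioi 0))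
      (nhds (L * (b - a) + L * 0)) :=
    Tendsto.mono_left ((continuous_const.add (continuous_const.mul continuous_id)).tendsto 0)
      nhdsWithin_le_nhds
  rw [mul_zero, add_zero] at hlim
  exact ge_of_tendsto hlim (eventually_nhdsWithin_of_forall fun d hd' => hd d hd')

variable {n : ℕ} {xc xr : Fin n → Ω → ℝ} {L γ ε : ℝ}

/-- From r ≤ 1 + r^(1+ε) for r ≥ 0. The mean radius is all that the clique bound uses of the moment
condition. -/
theorem lintegral_radius_le (hε : 0 < ε) (h : Model P xc xr L γ ε) (j : Fin n) :
    ∫⁻ w, ENNReal.ofReal (xr j w) ∂P ≤ ENNReal.ofReal (1 + γ) := by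
  have hint : Integrable (fun w => 1 + xr j w ^ (1 + ε)) P :=
    (integrable_const (1 : ℝ)).add (h.integrable_moment j)
  calc ∫⁻ w, ENNReal.ofReal (xr j w) ∂P
      ≤ ∫⁻ w, ENNReal.ofReal (1 + xr j w ^ (1 + ε)) ∂P := by
        refine lintegral_mono_ae ?_
        filter_upwards [h.radius_nonneg j] with w hw
        refine ENNReal.ofReal_le_ofReal ?_
        rcases le_total (xr j w) 1 with h₁ | h₁
        · linarith [Real.rpow_nonneg hw (1 + ε)]
        · have := Real.self_le_rpow_of_one_le h₁ (by linarith : 1 ≤ 1 + ε)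
          linarith
    _ = ENNReal.ofReal (∫ w, 1 + xr j w ^ (1 + ε) ∂P) := by
        rw [ofReal_integral_eq_lintegral_ofReal hint]
        filter_upwards [h.radius_nonneg j] with w hw
        have := Real.rpow_nonneg hw (1 + ε)
        simp only [Pi.zero_apply]
        positivity
    _ ≤ ENNReal.ofReal (1 + γ) := by
        refine ENNReal.ofReal_le_ofReal ?_
        rw [integral_add (integrable_const _) (h.integrable_moment j)]
        have := h.moment_le j
        simp
        linarith

theorem gamma_nonneg (h : Model P xc xr L γ ε) (j : Fin n) : 0 ≤ γ := by
  refine le_trans (integral_nonneg_of_ae ?_) (h.moment_le j)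
  filter_upwards [h.radius_nonneg j] with w hw
  exact Real.rpow_nonneg hw _

/-- For a fixed radius r the center must hit an interval of length 2cr, which has probability at
most 2Lcr; averaging over r brings in the mean radius. -/
theorem lintegral_neighbor_le (hL : 0 < L) (hε : 0 < ε) (h : Model P xc xr L γ ε)
    (Q : ℝ≥0∞) (c : ℝ) (hc : 0 ≤ c) (j : Fin n) (t : ℝ) :
    ∫⁻ r, ∫⁻ s, (if |t - s| ≤ c * r then Q else 1) ∂P.map (xc j) ∂P.map (xr j) ≤
      1 + Q * ENNReal.ofReal (2 * L * c * (1 + γ)) := by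
  have hpc : IsProbabilityMeasure (P.map (xc j)) :=
    Measure.isProbabilityMeasure_map (h.measurable_center j).aemeasurable
  have hpr : IsProbabilityMeasure (P.map (xr j)) :=
    Measure.isProbabilityMeasure_map (h.measurable_radius j).aemeasurable
  have hinner : ∀ r, 0 ≤ r →
      ∫⁻ s, (if |t - s| ≤ c * r then Q else 1) ∂P.map (xc j) ≤
        1 + Q * ENNReal.ofReal (2 * L * c) * ENNReal.ofReal r := by
    intro r hr
    calc ∫⁻ s, (if |t - s| ≤ c * r then Q else 1) ∂P.map (xc j)
        ≤ ∫⁻ s, 1 + (Set.Icc (t - c * r) (t + c * r)).indicator (fun _ => Q) s ∂P.map (xc j) := by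
          refine lintegral_mono fun s => ?_
          dsimp only
          split_ifs with hs
          · rw [abs_le] at hs
            rw [Set.indicator_of_mem (Set.mem_Icc.2 ⟨by linarith, by linarith⟩)]
            exact le_add_self
          · exact le_self_add
      _ = 1 + Q * P.map (xc j) (Set.Icc (t - c * r) (t + c * r)) := by
          rw [lintegral_add_left measurable_const, lintegral_indicator_const measurableSet_Icc]
          simp
      _ ≤ 1 + Q * ENNReal.ofReal (2 * L * c) * ENNReal.ofReal r := by
          have hcr : 0 ≤ c * r := mul_nonneg hc hr
          have := measure_Icc_le (h.measurable_center j) (h.lipschitz_cdf j)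
            (by linarith : t - c * r ≤ t + c * r)
          rw [mul_assoc, ← ENNReal.ofReal_mul (by positivity)]
          rw [show L * (t + c * r - (t - c * r)) = 2 * L * c * r by ring] at this
          gcongr
  have hae : ∀ᵐ r ∂P.map (xr j), 0 ≤ r :=
    (ae_map_iff (h.measurable_radius j).aemeasurable measurableSet_Ici).2 (h.radius_nonneg j)
  calc ∫⁻ r, ∫⁻ s, (if |t - s| ≤ c * r then Q else 1) ∂P.map (xc j) ∂P.map (xr j)
      ≤ ∫⁻ r, 1 + Q * ENNReal.ofReal (2 * L * c) * ENNReal.ofReal r ∂P.map (xr j) :=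
        lintegral_mono_ae (by filter_upwards [hae] with r hr using hinner r hr)
    _ = 1 + Q * ENNReal.ofReal (2 * L * c) * ∫⁻ w, ENNReal.ofReal (xr j w) ∂P := by
        rw [lintegral_add_left measurable_const, lintegral_const_mul _ ENNReal.measurable_ofReal,
          lintegral_map ENNReal.measurable_ofReal (h.measurable_radius j)]
        simp
    _ ≤ 1 + Q * ENNReal.ofReal (2 * L * c * (1 + γ)) := by
        rw [ENNReal.ofReal_mul (p := 2 * L * c) (by positivity), ← mul_assoc]
        exact add_le_add_right (mul_le_mul_right (lintegral_radius_le hε h j) _) _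

theorem lintegral_pow_omega_le (hn : 0 < n) (hL : 0 < L) (hε : 0 < ε)
    (h : Model P xc xr L γ ε) {Q : ℕ} (hQ : 1 ≤ Q) :
    ∫⁻ w, (Q : ℝ≥0∞) ^ randomOmega xc xr w ∂P ≤
      ENNReal.ofReal (n * Q * Real.exp (4 * L * (1 + γ) * Q)) := by
  obtain ⟨m, rfl⟩ : ∃ m, n = m + 1 := ⟨n - 1, by omega⟩
  have hγ := gamma_nonneg h 0
  set G : ℝ × ℝ × ℝ → ℝ≥0∞ := fun p => if |p.1 - p.2.1| ≤ 2 / (m + 1) * p.2.2 then (Q : ℝ≥0∞) else 1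
    with hGdef
  have hG : Measurable G :=
    Measurable.ite (measurableSet_le (by fun_prop) (by fun_prop)) measurable_const measurable_const
  -- With c = 2/n each factor has mean at most 1 + y ≤ exp(y), and the product of the n - 1 factors
  -- stays below exp(ny), which does not depend on n.
  set y : ℝ := 4 * L * (1 + γ) * Q / (m + 1) with hy
  have hy0 : 0 ≤ y := by positivity
  have hb : 1 + (Q : ℝ≥0∞) * ENNReal.ofReal (2 * L * (2 / (m + 1)) * (1 + γ)) ≤
      ENNReal.ofReal (Real.exp y) := by
    rw [← ENNReal.ofReal_natCast, ← ENNReal.ofReal_mul (by positivity), ← ENNReal.ofReal_one,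
      ← ENNReal.ofReal_add (by norm_num) (by positivity)]
    refine ENNReal.ofReal_le_ofReal ?_
    have := Real.add_one_le_exp y
    have e : (Q : ℝ) * (2 * L * (2 / (m + 1)) * (1 + γ)) = y := by rw [hy]; ring
    linarith
  have hterm := fun i => lintegral_prod_le h.measurable_center h.measurable_radius h.iIndep_center
    h.iIndep_radius h.indep_center_radius G hG _
    (fun j t => (lintegral_neighbor_le hL hε h Q (2 / (m + 1)) (by positivity) j t).trans hb) i
  have hmeas : ∀ i, Measurable fun w =>
      ∏ k, G (xc i w, xc (Fin.succAbove i k) w, xr (Fin.succAbove i k) w) := fun i =>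
    Finset.measurable_prod _ fun k _ => hG.comp ((h.measurable_center _).prodMk
      ((h.measurable_center _).prodMk (h.measurable_radius _)))
  calc ∫⁻ w, (Q : ℝ≥0∞) ^ randomOmega xc xr w ∂P
      ≤ ∫⁻ w, Q * ∑ i, ∏ k, G (xc i w, xc (Fin.succAbove i k) w, xr (Fin.succAbove i k) w) ∂P := by
        refine lintegral_mono fun w => ?_
        have := pow_omega_le hQ (fun i => xc i w) (fun i => xr i w)
        have h' := (Nat.cast_le (α := ℝ≥0∞)).2 this
        push_cast at h'
        exact h'
    _ = Q * ∑ i, ∫⁻ w, ∏ k, G (xc i w, xc (Fin.succAbove i k) w, xr (Fin.succAbove i k) w) ∂P := by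
        rw [lintegral_const_mul _ (Finset.measurable_sum _ fun i _ => hmeas i),
          lintegral_finsetSum _ fun i _ => hmeas i]
    _ ≤ Q * ∑ _i : Fin (m + 1), ENNReal.ofReal (Real.exp y) ^ m := by
        gcongr with i
        exact hterm i
    _ = ENNReal.ofReal ((m + 1 : ℕ) * Q * Real.exp y ^ m) := by
        rw [Finset.sum_const, Finset.card_univ, Fintype.card_fin, nsmul_eq_mul,
          ENNReal.ofReal_mul (by positivity), ENNReal.ofReal_mul (by positivity),
          ENNReal.ofReal_natCast, ENNReal.ofReal_natCast, ENNReal.ofReal_pow (by positivity)]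
        ring
    _ ≤ _ := by
        refine ENNReal.ofReal_le_ofReal ?_
        rw [← Real.exp_nat_mul]
        refine mul_le_mul_of_nonneg_left (Real.exp_le_exp.2 ?_) (by positivity)
        rw [hy, mul_div_assoc', div_le_iff₀ (by positivity)]
        nlinarith [show 0 ≤ 4 * L * (1 + γ) * Q by positivity]

end CliqueMoment

/-! ### Asymptotics -/

section Asymptotics

theorem tendsto_log_natCast : Tendsto (fun n : ℕ => Real.log n) atTop atTop :=
  Real.tendsto_log_atTop.comp tendsto_natCast_atTop_atTop

theorem tendsto_log_log_natCast : Tendsto (fun n : ℕ => Real.log (Real.log n)) atTop atTop :=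
  Real.tendsto_log_atTop.comp tendsto_log_natCast

theorem runningTime_le_real {n : ℕ} {lo up : Fin n → ℝ} (hn : 0 < n) (h : lo ≤ up) :
    (runningTime lo up : ℝ) ≤ 20 * (n * Real.log n) + 206 * (n * 2 ^ omega lo up) := by
  have h₁ : (runningTime lo up : ℝ) ≤
      10 * n * (Nat.clog 2 (2 * n) : ℕ) + 175 * n * 2 ^ omega lo up + 11 := by
    exact_mod_cast runningTime_le_omega h
  have h₂ : (Nat.clog 2 (2 * n) : ℝ) ≤ 2 * Real.log n + 2 := by
    have e : Nat.clog 2 (2 * n) ≤ Nat.log 2 n + 2 := by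
      refine (Nat.clog_le_iff_le_pow (by norm_num)).2 ?_
      have := Nat.lt_pow_succ_log_self (b := 2) (by norm_num) n
      rw [show Nat.log 2 n + 2 = (Nat.log 2 n).succ + 1 from rfl, pow_succ]
      omega
    have e₂ : (Nat.log 2 n : ℝ) ≤ Real.logb 2 n := by exact_mod_cast Real.natLog_le_logb n 2
    have e₃ : Real.logb 2 n ≤ 2 * Real.log n := by
      have : 0 ≤ Real.log n := Real.log_natCast_nonneg n
      rw [Real.logb, div_le_iff₀ (Real.log_pos (by norm_num))]
      nlinarith [Real.log_two_gt_d9]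
    have e₄ : (Nat.clog 2 (2 * n) : ℝ) ≤ Nat.log 2 n + 2 := by exact_mod_cast e
    linarith
  have hn' : (1 : ℝ) ≤ n := by exact_mod_cast hn
  have h₃ : (1 : ℝ) ≤ 2 ^ omega lo up := one_le_pow₀ (by norm_num)
  have h₄ : (1 : ℝ) ≤ n * 2 ^ omega lo up := by nlinarith
  have h₅ : (n : ℝ) ≤ n * 2 ^ omega lo up := by nlinarith
  have h₆ : 10 * (n : ℝ) * (Nat.clog 2 (2 * n) : ℕ) ≤ 10 * n * (2 * Real.log n + 2) :=
    mul_le_mul_of_nonneg_left h₂ (by positivity)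
  -- With clog(2n) ≤ 2 log n + 2, the constant 206 collects 20 from the sorting term, 175 and 11,
  -- each multiplied by at most n 2^ω.
  linarith

/-- The constant 226 = 20 + 206 arises when both terms of `runningTime_le_real` are bounded by
multiples of n² 2^(cn/2). -/
theorem eventually_sq_lt_two_rpow {c : ℝ} (hc : 0 < c) :
    ∀ᶠ n : ℕ in atTop, 226 * (n : ℝ) ^ 2 < 2 ^ (c * n) := by
  have hr : (1 : ℝ) < 2 ^ c := Real.one_lt_rpow (by norm_num) hc
  have := tendsto_pow_const_div_const_pow_of_one_lt 2 hr
  filter_upwards [this.eventually (gt_mem_nhds (by norm_num : (0 : ℝ) < 1 / 226))] with n hn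
  rw [div_lt_iff₀ (by positivity)] at hn
  rw [Real.rpow_mul (by norm_num), Real.rpow_natCast]
  linarith

/-- If ω < cn/2, then T ≤ 226 n² 2^(cn/2), which is eventually smaller than 2^(cn). -/
theorem eventually_linear_omega {c : ℝ} (hc : 0 < c) :
    ∀ᶠ n : ℕ in atTop, ∀ lo up : Fin n → ℝ, lo ≤ up →
      (2 : ℝ) ^ (c * n) ≤ (runningTime lo up : ℝ) → c / 2 * n ≤ (omega lo up : ℝ) := by
  filter_upwards [eventually_sq_lt_two_rpow (half_pos hc), eventually_gt_atTop 0]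
    with n hn hn₀ lo up h hT
  by_contra! hlt
  have h₁ := hT.trans (runningTime_le_real hn₀ h)
  have hn' : (1 : ℝ) ≤ n := by exact_mod_cast hn₀
  set y : ℝ := 2 ^ (c / 2 * n) with hy
  have hy₁ : 1 ≤ y := Real.one_le_rpow (by norm_num) (by positivity)
  have h₂ : (2 : ℝ) ^ omega lo up ≤ y := by
    rw [← Real.rpow_natCast]
    exact Real.rpow_le_rpow_of_exponent_le (by norm_num) hlt.le
  have h₃ : (2 : ℝ) ^ (c * n) = y * y := by
    rw [hy, ← Real.rpow_add (by norm_num)]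
    congr 1
    ring
  have h₄ : Real.log n ≤ n := Real.log_le_self (by positivity)
  have h₅ : (n : ℝ) * Real.log n ≤ n * n * y := by
    have : (n : ℝ) * Real.log n ≤ n * n := mul_le_mul_of_nonneg_left h₄ (by positivity)
    nlinarith [show (0 : ℝ) ≤ n * n by positivity]
  have h₆ : (n : ℝ) * 2 ^ omega lo up ≤ n * n * y := by
    have : (n : ℝ) * 2 ^ omega lo up ≤ n * y := mul_le_mul_of_nonneg_left h₂ (by positivity)
    nlinarith [show 0 ≤ (n : ℝ) * y by positivity]
  rw [h₃] at h₁
  nlinarith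

theorem exponent_tendsto_zero :
    Tendsto (fun n : ℕ => 1 / Real.log (Real.log n)) atTop (nhds 0) := by
  simp only [one_div]
  exact tendsto_log_log_natCast.inv_tendsto_atTop

theorem isBigO_rpow_one_add {η : ℝ} (hη : 0 < η) :
    (fun n : ℕ => n * Real.log n + n * (n : ℝ) ^ (1 / Real.log (Real.log n))) =O[atTop]
      fun n : ℕ => (n : ℝ) ^ (1 + η) := by
  have h₁ := (isLittleO_log_rpow_atTop hη).comp_tendsto tendsto_natCast_atTop_atTop
  refine IsBigO.of_bound 2 ?_
  filter_upwards [h₁.bound one_pos, exponent_tendsto_zero.eventually (ge_mem_nhds hη),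
    eventually_gt_atTop 0] with n hlog he hn
  have hn' : (1 : ℝ) ≤ n := by exact_mod_cast hn
  have hn₀ : (0 : ℝ) < n := by linarith
  have hl : 0 ≤ Real.log n := Real.log_natCast_nonneg n
  simp only [Function.comp_apply, one_mul] at hlog
  rw [Real.norm_of_nonneg hl, Real.norm_of_nonneg (by positivity)] at hlog
  have h₂ : (n : ℝ) ^ (1 / Real.log (Real.log n)) ≤ (n : ℝ) ^ η :=
    Real.rpow_le_rpow_of_exponent_le hn' he
  rw [Real.norm_of_nonneg (by positivity), Real.norm_of_nonneg (by positivity),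
    Real.rpow_add hn₀, Real.rpow_one]
  nlinarith

/-- Used with x = log n. The power is at most 2x^((6/5) log 2), and it is o(x) because (6/5) log 2 <
1. -/
theorem eventually_two_pow_le (A : ℝ) : ∀ᶠ x : ℝ in atTop,
    A * 2 ^ ⌈6 / 5 * Real.log x⌉₊ ≤ x / 5 := by
  have hs : 6 / 5 * Real.log 2 < 1 := by linarith [Real.log_two_lt_d9]
  have h := tendsto_rpow_neg_atTop (sub_pos.2 hs)
  have hpos : (0 : ℝ) < 1 / (10 * (|A| + 1)) := by positivity
  filter_upwards [h.eventually (ge_mem_nhds hpos), eventually_ge_atTop 1] with x hx₂ hx₁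
  have hx₀ : 0 < x := by linarith
  have hx : x ^ (6 / 5 * Real.log 2) ≤ 1 / (10 * (|A| + 1)) * x := by
    rw [neg_sub, Real.rpow_sub_one hx₀.ne', div_le_iff₀ hx₀] at hx₂
    exact hx₂
  have h₁ : (2 : ℝ) ^ ⌈6 / 5 * Real.log x⌉₊ ≤ 2 * x ^ (6 / 5 * Real.log 2) := by
    have hl : 0 ≤ 6 / 5 * Real.log x := by
      have := Real.log_nonneg hx₁
      positivity
    rw [← Real.rpow_natCast]
    calc (2 : ℝ) ^ ((⌈6 / 5 * Real.log x⌉₊ : ℕ) : ℝ) ≤ 2 ^ (6 / 5 * Real.log x + 1) :=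
          Real.rpow_le_rpow_of_exponent_le (by norm_num) (Nat.ceil_lt_add_one hl).le
      _ = 2 * x ^ (6 / 5 * Real.log 2) := by
          rw [Real.rpow_add (by norm_num), Real.rpow_one, Real.rpow_def_of_pos (by norm_num),
            Real.rpow_def_of_pos hx₀]
          ring_nf
  have h₂ : A * 2 ^ ⌈6 / 5 * Real.log x⌉₊ ≤ (|A| + 1) * 2 ^ ⌈6 / 5 * Real.log x⌉₊ :=
    mul_le_mul_of_nonneg_right (by linarith [le_abs_self A]) (by positivity)
  have h₃ : (|A| + 1) * 2 ^ ⌈6 / 5 * Real.log x⌉₊ ≤ (|A| + 1) * (2 * (1 / (10 * (|A| + 1)) * x)) :=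
    mul_le_mul_of_nonneg_left (h₁.trans (by linarith)) (by positivity)
  have h₄ : (|A| + 1) * (2 * (1 / (10 * (|A| + 1)) * x)) = x / 5 := by
    field_simp
    norm_num
  linarith

end Asymptotics

/-! ### Integrability, moments and Markov's inequality for 2^ω -/

section Expectation

variable {Ω : Type*} [MeasurableSpace Ω] {P : Measure Ω} [IsProbabilityMeasure P]
variable {n : ℕ} {xc xr : Fin n → Ω → ℝ} {L γ ε : ℝ}

theorem omega_le (lo up : Fin n → ℝ) : omega lo up ≤ n := by
  obtain ⟨S, hS, -⟩ := exists_omega_clique lo up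
  rw [← hS]
  simpa using S.card_le_univ

theorem integrable_pow_omega (h : Model P xc xr L γ ε) (Q : ℕ) (hQ : 1 ≤ Q) :
    Integrable (fun w => (Q : ℝ) ^ randomOmega xc xr w) P := by
  have hm := measurable_randomOmega h.measurable_center h.measurable_radius
  refine Integrable.of_bound (C := (Q : ℝ) ^ n)
    ((measurable_from_nat (f := fun k => (Q : ℝ) ^ k)).comp hm).aestronglyMeasurable ?_
  refine ae_of_all _ fun w => ?_
  rw [Real.norm_of_nonneg (by positivity)]
  exact pow_le_pow_right₀ (by exact_mod_cast hQ) (omega_le _ _)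

theorem integral_pow_omega_le (hn : 0 < n) (hL : 0 < L) (hε : 0 < ε)
    (h : Model P xc xr L γ ε) {Q : ℕ} (hQ : 1 ≤ Q) :
    ∫ w, (Q : ℝ) ^ randomOmega xc xr w ∂P ≤ n * Q * Real.exp (4 * L * (1 + γ) * Q) := by
  have h₁ := lintegral_pow_omega_le hn hL hε h hQ
  rw [← ENNReal.ofReal_le_ofReal_iff (by positivity),
    ofReal_integral_eq_lintegral_ofReal (integrable_pow_omega h Q hQ)
      (ae_of_all _ fun w => by simp only [Pi.zero_apply]; positivity)]
  refine le_trans (lintegral_mono fun w => ?_) h₁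
  rw [ENNReal.ofReal_pow (by positivity), ENNReal.ofReal_natCast]

theorem ae_le (h : Model P xc xr L γ ε) :
    ∀ᵐ w ∂P, (fun i => xc i w - xr i w) ≤ fun i => xc i w + xr i w := by
  filter_upwards [ae_all_iff.2 h.radius_nonneg] with w hw i
  linarith [hw i]

theorem integrable_two_pow_omega (h : Model P xc xr L γ ε) :
    Integrable (fun w => (2 : ℝ) ^ randomOmega xc xr w) P :=
  integrable_pow_omega h 2 (by norm_num)

theorem integrable_randomTime (h : Model P xc xr L γ ε) :
    Integrable (fun w => (randomTime xc xr w : ℝ)) P := by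
  have hm := measurable_randomTime h.measurable_center h.measurable_radius
  refine Integrable.of_bound
    (C := ((10 * n * Nat.clog 2 (2 * n) + 175 * n * 2 ^ n + 11 : ℕ) : ℝ))
    ((measurable_from_nat (f := fun k => (k : ℝ))).comp hm).aestronglyMeasurable ?_
  filter_upwards [ae_le h] with w hw
  rw [Real.norm_of_nonneg (by positivity), Nat.cast_le]
  refine (runningTime_le_omega hw).trans ?_
  have := Nat.pow_le_pow_right (n := 2) (by norm_num)
    (omega_le (fun i => xc i w - xr i w) (fun i => xc i w + xr i w))
  gcongr

theorem integral_randomTime_le (hn : 0 < n) (h : Model P xc xr L γ ε) :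
    ∫ w, (randomTime xc xr w : ℝ) ∂P ≤
      20 * (n * Real.log n) + 206 * (n * ∫ w, (2 : ℝ) ^ randomOmega xc xr w ∂P) := by
  have hint := integrable_two_pow_omega h
  calc ∫ w, (randomTime xc xr w : ℝ) ∂P
      ≤ ∫ w, 20 * (n * Real.log n) + 206 * (n * (2 : ℝ) ^ randomOmega xc xr w) ∂P := by
        refine integral_mono_ae (integrable_randomTime h)
          ((integrable_const _).add ((hint.const_mul _).const_mul _)) ?_
        filter_upwards [ae_le h] with w hw using runningTime_le_real hn hw
    _ = _ := by
        rw [integral_add (integrable_const _) ((hint.const_mul _).const_mul _),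
          integral_const, integral_const_mul, integral_const_mul]
        simp

/-- A bound for the expectation of `2 ^ ω` by the moment of order `p`. -/
theorem integral_two_pow_omega_le (hn : 0 < n) (hL : 0 < L) (hε : 0 < ε)
    (h : Model P xc xr L γ ε) {p : ℕ} (hp : 1 ≤ p) :
    ∫ w, (2 : ℝ) ^ randomOmega xc xr w ∂P ≤
      4 * Real.exp ((Real.log n + 4 * L * (1 + γ) * 2 ^ p) / p) := by
  have hn' : (0 : ℝ) < n := by exact_mod_cast hn
  have hp' : (0 : ℝ) < p := by exact_mod_cast hp
  -- The threshold is chosen so that t^p equals the bound for the mean of (2^p)^ω, the moment of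
  -- order p of 2^ω.
  set t : ℝ := 2 * Real.exp ((Real.log n + 4 * L * (1 + γ) * 2 ^ p) / p) with ht
  have ht₀ : 0 < t := by positivity
  have htp : t ^ p = n * (2 ^ p : ℕ) * Real.exp (4 * L * (1 + γ) * (2 ^ p : ℕ)) := by
    rw [ht, mul_pow, ← Real.exp_nat_mul, mul_div_cancel₀ _ hp'.ne', Real.exp_add,
      Real.exp_log hn']
    push_cast
    ring
  have hmom := integral_pow_omega_le hn hL hε h (Q := 2 ^ p) Nat.one_le_two_pow
  rw [← htp] at hmom
  have hint := integrable_pow_omega h (2 ^ p) Nat.one_le_two_pow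
  -- Truncation at `t`: y ≤ t + t(y/t)^p. After integration both terms are at most `t`, so the mean
  -- is at most 2t.
  have hpt : ∀ w, (2 : ℝ) ^ randomOmega xc xr w ≤
      t + t / t ^ p * ((2 ^ p : ℕ) : ℝ) ^ randomOmega xc xr w := by
    intro w
    set y : ℝ := 2 ^ randomOmega xc xr w with hy
    have hyp : ((2 ^ p : ℕ) : ℝ) ^ randomOmega xc xr w = y ^ p := by
      rw [hy]
      push_cast
      rw [← pow_mul, ← pow_mul, mul_comm]
    rw [hyp]
    rcases le_total y t with hyt | hyt
    · have : 0 ≤ t / t ^ p * y ^ p := by positivity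
      linarith
    · have h₁ : 1 ≤ y / t := (one_le_div ht₀).2 hyt
      have h₂ : y / t ≤ (y / t) ^ p := le_self_pow₀ h₁ (by omega)
      have h₃ : t / t ^ p * y ^ p = t * (y / t) ^ p := by
        rw [div_pow]
        ring
      have h₄ : t * (y / t) = y := mul_div_cancel₀ y ht₀.ne'
      rw [h₃]
      nlinarith [mul_le_mul_of_nonneg_left h₂ ht₀.le]
  calc ∫ w, (2 : ℝ) ^ randomOmega xc xr w ∂P
      ≤ ∫ w, t + t / t ^ p * ((2 ^ p : ℕ) : ℝ) ^ randomOmega xc xr w ∂P :=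
        integral_mono (integrable_two_pow_omega h)
          ((integrable_const _).add (hint.const_mul _)) hpt
    _ = t + t / t ^ p * ∫ w, ((2 ^ p : ℕ) : ℝ) ^ randomOmega xc xr w ∂P := by
        rw [integral_add (integrable_const _) (hint.const_mul _), integral_const, integral_const_mul]
        simp
    _ ≤ t + t / t ^ p * t ^ p := by gcongr
    _ = _ := by
        rw [div_mul_cancel₀ _ (by positivity), ht]
        ring

theorem measureReal_omega_mul_le (hn : 0 < n) (hL : 0 < L) (hε : 0 < ε)
    (h : Model P xc xr L γ ε) {Q : ℕ} (hQ : 1 ≤ Q) (s : ℝ) :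
    (Q : ℝ) ^ s * P.real {w | s ≤ (randomOmega xc xr w : ℝ)} ≤
      n * Q * Real.exp (4 * L * (1 + γ) * Q) := by
  refine le_trans ?_ (integral_pow_omega_le hn hL hε h hQ)
  refine le_trans ?_ (mul_meas_ge_le_integral_of_nonneg
    (ae_of_all _ fun w => by simp only [Pi.zero_apply]; positivity)
    (integrable_pow_omega h Q hQ) ((Q : ℝ) ^ s))
  refine mul_le_mul_of_nonneg_left (measureReal_mono fun w hw => ?_) (by positivity)
  change (Q : ℝ) ^ s ≤ (Q : ℝ) ^ randomOmega xc xr w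
  rw [← Real.rpow_natCast]
  exact Real.rpow_le_rpow_of_exponent_le (by exact_mod_cast hQ) hw

end Expectation

/-! ### Choice of the parameters as n tends to infinity -/

section Main

variable {Ω : ℕ → Type*} [∀ n, MeasurableSpace (Ω n)] {P : ∀ n, Measure (Ω n)}
  [∀ n, IsProbabilityMeasure (P n)] {xc xr : ∀ n, Fin n → Ω n → ℝ} {L γ ε : ℝ}

/-- With p = ⌈(6/5) log log n⌉ the term with 2^p is at most (log n)/5. The numerator of the exponent
is then at most (6/5) log n, and division by p ≥ (6/5) log log n cancels the factor 6/5. -/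
theorem eventually_integral_two_pow_omega_le (hL : 0 < L) (hε : 0 < ε)
    (h : ∀ n, Model (P n) (xc n) (xr n) L γ ε) :
    ∀ᶠ n : ℕ in atTop, ∫ w, (2 : ℝ) ^ randomOmega (xc n) (xr n) w ∂(P n) ≤
      4 * (n : ℝ) ^ (1 / Real.log (Real.log n)) := by
  filter_upwards [tendsto_log_natCast.eventually (eventually_two_pow_le (4 * L * (1 + γ))),
    tendsto_log_log_natCast.eventually_gt_atTop 0, tendsto_log_natCast.eventually_gt_atTop 0,
    eventually_gt_atTop 0] with n hA hll hl hn
  have hn' : (0 : ℝ) < n := by exact_mod_cast hn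
  have hp : 6 / 5 * Real.log (Real.log n) ≤ ⌈6 / 5 * Real.log (Real.log n)⌉₊ := Nat.le_ceil _
  have hp₁ : 1 ≤ ⌈6 / 5 * Real.log (Real.log n)⌉₊ := Nat.ceil_pos.2 (by positivity)
  refine (integral_two_pow_omega_le hn hL hε (h n) hp₁).trans ?_
  rw [Real.rpow_def_of_pos hn']
  refine mul_le_mul_of_nonneg_left (Real.exp_le_exp.2 ?_) (by norm_num)
  rw [mul_one_div]
  calc (Real.log n + 4 * L * (1 + γ) * 2 ^ ⌈6 / 5 * Real.log (Real.log n)⌉₊) /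
        (⌈6 / 5 * Real.log (Real.log n)⌉₊ : ℝ)
      ≤ (6 / 5 * Real.log n) / (⌈6 / 5 * Real.log (Real.log n)⌉₊ : ℝ) := by
        gcongr
        linarith
    _ ≤ (6 / 5 * Real.log n) / (6 / 5 * Real.log (Real.log n)) := by gcongr
    _ = Real.log n / Real.log (Real.log n) := by field_simp

theorem isBigO_measureReal_omega (hL : 0 < L) (hε : 0 < ε)
    (h : ∀ n, Model (P n) (xc n) (xr n) L γ ε) {δ : ℝ} (hδ : 0 < δ) :
    (fun n : ℕ => (P n).real {w | δ * n ≤ (randomOmega (xc n) (xr n) w : ℝ)}) =O[atTop]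
      fun n : ℕ => Real.exp (-(n * Real.log (Real.log n))) := by
  -- The sign of γ is read off from a radius, so the model is used at n = 1, where an index exists.
  have hγ : 0 ≤ γ := gamma_nonneg (h 1) 0
  set A : ℝ := 4 * L * (1 + γ) with hA
  have hA₀ : 0 ≤ A := by positivity
  have hll : ∀ᶠ n : ℕ in atTop, Real.log (Real.log n) ≤ δ / 4 * Real.log n := by
    filter_upwards [(Real.isLittleO_log_id_atTop.comp_tendsto tendsto_log_natCast).bound
      (by positivity : 0 < δ / 4), tendsto_log_natCast.eventually_gt_atTop 0] with n hn hl
    simp only [Function.comp_apply, id_eq] at hn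
    rw [Real.norm_of_nonneg hl.le] at hn
    exact (le_abs_self _).trans hn
  refine IsBigO.of_bound 1 ?_
  filter_upwards [hll, tendsto_log_natCast.eventually_ge_atTop ((3 + 2 * A) * (4 / δ)),
    eventually_gt_atTop 0] with n h₁ h₂ hn
  have hn₁ : (1 : ℝ) ≤ n := by exact_mod_cast hn
  have hn₀ : (0 : ℝ) < n := by linarith
  have hsq : 1 ≤ √(n : ℝ) := Real.one_le_sqrt.2 hn₁
  have hsqn : √(n : ℝ) ≤ n := by
    nlinarith [Real.sq_sqrt hn₀.le]
  -- For this Q the Markov factor Q^(δn) is at least exp((δ/2) n log n), while the moment bound is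
  -- only exp(O(n)).
  set Q : ℕ := ⌈√(n : ℝ)⌉₊ with hQ
  have hQ₁ : √(n : ℝ) ≤ Q := Nat.le_ceil _
  have hQ₂ : (Q : ℝ) ≤ 2 * n := by
    have := (Nat.ceil_lt_add_one (Real.sqrt_nonneg (n : ℝ))).le
    linarith
  have hQ₃ : 1 ≤ Q := Nat.ceil_pos.2 (by positivity)
  have hm := measureReal_omega_mul_le hn hL hε (h n) hQ₃ (δ * n)
  have hpow : Real.exp (δ / 2 * n * Real.log n) ≤ (Q : ℝ) ^ (δ * n) := by
    calc Real.exp (δ / 2 * n * Real.log n) = √(n : ℝ) ^ (δ * n) := by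
          rw [Real.rpow_def_of_pos (by positivity), Real.log_sqrt hn₀.le]
          ring_nf
      _ ≤ _ := Real.rpow_le_rpow (by positivity) hQ₁ (by positivity)
  have hrhs : n * Q * Real.exp (A * Q) ≤ Real.exp ((3 + 2 * A) * n) := by
    have e₁ : (n : ℝ) ≤ Real.exp n := by linarith [Real.add_one_le_exp (n : ℝ)]
    have e₂ : (Q : ℝ) ≤ Real.exp (2 * n) := by linarith [Real.add_one_le_exp (2 * (n : ℝ))]
    calc n * Q * Real.exp (A * Q) ≤ Real.exp n * Real.exp (2 * n) * Real.exp (A * (2 * n)) := by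
          gcongr
      _ = _ := by
          rw [← Real.exp_add, ← Real.exp_add]
          ring_nf
  -- The gain (δ/2) n log n is halved: one part (δ/4) n log n absorbs (3 + 2A)n, the other absorbs n
  -- log log n.
  have hexp : (3 + 2 * A) * n ≤ δ / 2 * n * Real.log n - n * Real.log (Real.log n) := by
    have e₁ : 3 + 2 * A ≤ δ / 4 * Real.log n := by
      calc 3 + 2 * A = δ / 4 * ((3 + 2 * A) * (4 / δ)) := by field_simp
        _ ≤ _ := mul_le_mul_of_nonneg_left h₂ (by positivity)
    nlinarith
  rw [one_mul, Real.norm_of_nonneg measureReal_nonneg, Real.norm_of_nonneg (Real.exp_pos _).le]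
  have hfin : Real.exp (δ / 2 * n * Real.log n) *
      (P n).real {w | δ * n ≤ (randomOmega (xc n) (xr n) w : ℝ)} ≤
      Real.exp (δ / 2 * n * Real.log n) * Real.exp (-(n * Real.log (Real.log n))) := by
    rw [← Real.exp_add]
    calc _ ≤ (Q : ℝ) ^ (δ * n) * (P n).real {w | δ * n ≤ (randomOmega (xc n) (xr n) w : ℝ)} :=
          mul_le_mul_of_nonneg_right hpow measureReal_nonneg
      _ ≤ Real.exp ((3 + 2 * A) * n) := hm.trans hrhs
      _ ≤ _ := Real.exp_le_exp.2 (by linarith)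
  exact le_of_mul_le_mul_left hfin (Real.exp_pos _)

end Main

end FGKLA

theorem mainTheorem3
    {Ω : ℕ → Type*} [∀ n, MeasurableSpace (Ω n)] (P : ∀ n, Measure (Ω n))
    [∀ n, IsProbabilityMeasure (P n)] (xc xr : ∀ n, Fin n → Ω n → ℝ)
    (L γ ε : ℝ) (hL : 0 < L) (hε : 0 < ε) (hε' : ε ≤ 1)
    (hmodel : ∀ n, FGKLA.Model (P n) (xc n) (xr n) L γ ε) :
    -- the expectations below exist
    (∀ n, Integrable (fun w => (FGKLA.randomTime (xc n) (xr n) w : ℝ)) (P n)) ∧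
    (∀ n, Integrable (fun w => (2 : ℝ) ^ FGKLA.randomOmega (xc n) (xr n) w) (P n)) ∧
    -- the chain of bounds on the expected running time
    ((fun n : ℕ => ∫ w, (FGKLA.randomTime (xc n) (xr n) w : ℝ) ∂(P n)) =O[atTop]
      fun n : ℕ => n * Real.log n +
        n * ∫ w, (2 : ℝ) ^ FGKLA.randomOmega (xc n) (xr n) w ∂(P n)) ∧
    ((fun n : ℕ => n * Real.log n +
        n * ∫ w, (2 : ℝ) ^ FGKLA.randomOmega (xc n) (xr n) w ∂(P n)) =O[atTop]
      fun n : ℕ => n * Real.log n + n * (n : ℝ) ^ (1 / Real.log (Real.log n))) ∧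
    ((fun n : ℕ => ∫ w, (FGKLA.randomTime (xc n) (xr n) w : ℝ) ∂(P n)) =O[atTop]
      fun n : ℕ => n * Real.log n + n * (n : ℝ) ^ (1 / Real.log (Real.log n))) ∧
    (∀ η : ℝ, 0 < η →
      ((fun n : ℕ => n * Real.log n + n * (n : ℝ) ^ (1 / Real.log (Real.log n))) =O[atTop]
        fun n : ℕ => (n : ℝ) ^ (1 + η)) ∧
      ((fun n : ℕ => ∫ w, (FGKLA.randomTime (xc n) (xr n) w : ℝ) ∂(P n)) =O[atTop]
        fun n : ℕ => (n : ℝ) ^ (1 + η))) ∧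
    -- if the clique number is linear, then the running time is exponential
    (∀ δ : ℝ, 0 < δ → ∃ c : ℝ, 0 < c ∧ ∀ᶠ n : ℕ in atTop, ∀ lo up : Fin n → ℝ, lo ≤ up →
      δ * n ≤ (FGKLA.omega lo up : ℝ) →
        (2 : ℝ) ^ (c * n) ≤ (FGKLA.runningTime lo up : ℝ)) ∧
    -- if the running time is exponential, then the clique number is linear
    (∀ c : ℝ, 0 < c → ∃ δ : ℝ, 0 < δ ∧ ∀ᶠ n : ℕ in atTop, ∀ lo up : Fin n → ℝ, lo ≤ up →
      (2 : ℝ) ^ (c * n) ≤ (FGKLA.runningTime lo up : ℝ) →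
        δ * n ≤ (FGKLA.omega lo up : ℝ)) ∧
    -- both events are rare
    (∀ δ : ℝ, 0 < δ →
      (fun n : ℕ => (P n).real {w | δ * n ≤ (FGKLA.randomOmega (xc n) (xr n) w : ℝ)}) =O[atTop]
        fun n : ℕ => Real.exp (-(n * Real.log (Real.log n)))) ∧
    (∀ c : ℝ, 0 < c →
      (fun n : ℕ =>
          (P n).real {w | (2 : ℝ) ^ (c * n) ≤ (FGKLA.randomTime (xc n) (xr n) w : ℝ)}) =O[atTop]
        fun n : ℕ => Real.exp (-(n * Real.log (Real.log n)))) := by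
  have hT₁ : (fun n : ℕ => ∫ w, (FGKLA.randomTime (xc n) (xr n) w : ℝ) ∂(P n)) =O[atTop]
      fun n : ℕ => n * Real.log n +
        n * ∫ w, (2 : ℝ) ^ FGKLA.randomOmega (xc n) (xr n) w ∂(P n) := by
    refine IsBigO.of_bound 206 ?_
    filter_upwards [eventually_gt_atTop 0] with n hn
    have h₁ := FGKLA.integral_randomTime_le hn (hmodel n)
    have h₂ : 0 ≤ (n : ℝ) * Real.log n := mul_nonneg n.cast_nonneg (Real.log_natCast_nonneg n)
    have h₃ : 0 ≤ ∫ w, (2 : ℝ) ^ FGKLA.randomOmega (xc n) (xr n) w ∂(P n) :=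
      integral_nonneg fun w => by positivity
    rw [Real.norm_of_nonneg (integral_nonneg fun w => Nat.cast_nonneg _),
      Real.norm_of_nonneg (by positivity)]
    linarith
  have hT₂ : (fun n : ℕ => n * Real.log n +
        n * ∫ w, (2 : ℝ) ^ FGKLA.randomOmega (xc n) (xr n) w ∂(P n)) =O[atTop]
      fun n : ℕ => n * Real.log n + n * (n : ℝ) ^ (1 / Real.log (Real.log n)) := by
    refine IsBigO.of_bound 4 ?_
    filter_upwards [FGKLA.eventually_integral_two_pow_omega_le hL hε hmodel] with n h₁
    have h₂ : 0 ≤ (n : ℝ) * Real.log n := mul_nonneg n.cast_nonneg (Real.log_natCast_nonneg n)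
    have h₃ : 0 ≤ ∫ w, (2 : ℝ) ^ FGKLA.randomOmega (xc n) (xr n) w ∂(P n) :=
      integral_nonneg fun w => by positivity
    rw [Real.norm_of_nonneg (by positivity), Real.norm_of_nonneg (by positivity)]
    linarith [mul_le_mul_of_nonneg_left h₁ (n.cast_nonneg : (0 : ℝ) ≤ n)]
  refine ⟨fun n => FGKLA.integrable_randomTime (hmodel n),
    fun n => FGKLA.integrable_two_pow_omega (hmodel n), hT₁, hT₂, hT₁.trans hT₂,
    fun η hη => ⟨FGKLA.isBigO_rpow_one_add hη,
      (hT₁.trans hT₂).trans (FGKLA.isBigO_rpow_one_add hη)⟩,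
    fun δ hδ => ⟨δ, hδ, Eventually.of_forall fun n lo up h hω => ?_⟩,
    fun c hc => ⟨c / 2, half_pos hc, FGKLA.eventually_linear_omega hc⟩,
    fun δ hδ => FGKLA.isBigO_measureReal_omega hL hε hmodel hδ, fun c hc => ?_⟩
  · calc (2 : ℝ) ^ (δ * n) ≤ 2 ^ (FGKLA.omega lo up : ℝ) :=
          Real.rpow_le_rpow_of_exponent_le (by norm_num) hω
      _ ≤ (FGKLA.runningTime lo up : ℝ) := by
          rw [Real.rpow_natCast]
          exact_mod_cast FGKLA.two_pow_omega_le_runningTime h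
  · refine IsBigO.trans (IsBigO.of_bound 1 ?_)
      (FGKLA.isBigO_measureReal_omega hL hε hmodel (half_pos hc))
    filter_upwards [FGKLA.eventually_linear_omega hc] with n hn
    rw [one_mul, Real.norm_of_nonneg measureReal_nonneg, Real.norm_of_nonneg measureReal_nonneg]
    -- The inclusion of events holds only almost everywhere, since the intervals are nonempty only
    -- where the radii are nonnegative.
    refine ENNReal.toReal_mono (measure_ne_top _ _) (measure_mono_ae ?_)
    filter_upwards [FGKLA.ae_le (hmodel n)] with w hw hT using hn _ _ hw hT
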